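/- By a curve over $\mathbb{Q}$ we mean a smooth projective geometrically irreducible variety of dimension $1$ over $\mathbb{Q}$. An algebraic extension $K/\mathbb{Q}$ of finite degree is called primitive if there is no field $L$ with $\mathbb{Q}\subsetneq L\subsetneq K$. A subset of $\mathbb{P}^1(\mathbb{Q})$ is thin if it is contained in a finite union of sets $A$, each of which is either contained in $Z(\mathbb{Q})$ for a proper Zariski-closed $Z\subsetneq\mathbb{P}^1$, or contained in $\pi(W(\mathbb{Q}))$ for an irreducible variety $W$ over $\mathbb{Q}$ and a dominant, generically finite morphism $\pi: W\to\mathbb{P}^1$ over $\mathbb{Q}$ of degree at least $2$. For a morphism $f$ to $\mathbb{P}^1$ and $\beta\in\mathbb{P}^1(\mathbb{Q})$, $f^{-1}(\beta)$ denotes the set of $\overline{\mathbb{Q}}$-points above $\beta$. **Proposition.** Let $C$ be a curve over $\mathbb{Q}$, let $f: C\to\mathbb{P}^1$ be a non-constant morphism defined over $\mathbb{Q}$, and let $d=\deg f$. Let $\alpha\in\mathbb{P}^1(\mathbb{Q})$. Suppose that $\alpha$ is not a branch value of $f$ and that the fibre $f^{-1}(\alpha)\subset C(\overline{\mathbb{Q}})$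 consists of a single $\mathrm{Gal}(\overline{\mathbb{Q}}/\mathbb{Q})$-orbit of points. Let $P\in f^{-1}(\alpha)$ and suppose that the field $\mathbb{Q}(P)$ is primitive. Then $[\mathbb{Q}(P):\mathbb{Q}]=d$, and there is a thin set $S\subset\mathbb{P}^1(\mathbb{Q})$ such that for every $\beta\in\mathbb{P}^1(\mathbb{Q})\setminus S$ the fibre $f^{-1}(\beta)$ consists of a single Galois orbit of points and, for every $Q\in f^{-1}(\beta)$, the field $\mathbb{Q}(Q)$ is primitive of degree $d$ over $\mathbb{Q}$. -/

import Mathlib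

open CategoryTheory AlgebraicGeometry

noncomputable section

namespace PrimPts

/-! ### Schemes over `ℚ` and their points -/

/-- The base scheme `Spec ℚ`. -/
abbrev base : Scheme.{0} := Spec (CommRingCat.of ℚ)

/-- Schemes over `ℚ`; morphisms `X ⟶ Y` in this category are the morphisms defined over `ℚ`. -/
abbrev QSch : Type 1 := Over base

/-- A fixed algebraic closure of `ℚ`. -/
abbrev Qbar : Type := AlgebraicClosure ℚ

/-- `Spec Qbar` as a scheme over `ℚ`. -/
def specQbar : QSch := Over.mk (Spec.map (CommRingCat.ofHom (algebraMap ℚ Qbar)))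

/-- The set `X(ℚ)` of rational points: sections of the structure morphism. -/
abbrev RatPt (X : QSch) : Type := Over.mk (𝟙 base) ⟶ X

/-- The set `X(Qbar)` of algebraic points. -/
abbrev AlgPt (X : QSch) : Type := specQbar ⟶ X

/-- The point of the underlying topological space on which a rational point is supported. -/
def RatPt.pt {X : QSch} (a : RatPt X) : X.left := a.left (IsLocalRing.closedPoint ℚ)

/-- The inclusion `X(ℚ) → X(Qbar)`. -/
def RatPt.toAlgPt {X : QSch} (a : RatPt X) : AlgPt X := Over.mkIdTerminal.from specQbar ≫ a

/-- The morphism `Spec Qbar ⟶ Spec Qbar` over `ℚ` induced by `σ ∈ Gal(Qbar/ℚ)`. -/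
def specGal (σ : Qbar ≃ₐ[ℚ] Qbar) : specQbar ⟶ specQbar :=
  Over.homMk (Spec.map (CommRingCat.ofHom (σ : Qbar →+* Qbar))) (by
    change Spec.map _ ≫ Spec.map _ = Spec.map _
    rw [← Spec.map_comp, ← CommRingCat.ofHom_comp]
    congr 2
    exact σ.toAlgHom.comp_algebraMap)

/-- The Galois conjugate `σ(P)` of an algebraic point `P`. -/
def AlgPt.conj {X : QSch} (σ : Qbar ≃ₐ[ℚ] Qbar) (P : AlgPt X) : AlgPt X := specGal σ ≫ P

/-- A set of algebraic points is a single Galois orbit. -/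
def IsGaloisOrbit {X : QSch} (F : Set (AlgPt X)) : Prop :=
  ∃ P : AlgPt X, F = Set.range fun σ : Qbar ≃ₐ[ℚ] Qbar => P.conj σ

/-- The field `ℚ(P)` of an algebraic point `P`: the image in `Qbar` of the residue field of the
closed point of `X` on which `P` is supported. -/
def AlgPt.field {X : QSch} (P : AlgPt X) : IntermediateField ℚ Qbar :=
  IntermediateField.adjoin ℚ
    (Set.range ((Scheme.SpecToEquivOfField Qbar X.left P.left).2 : _ → Qbar))

/-- An algebraic extension `K` of `ℚ` is primitive if there is no field `L` with
`ℚ ⊊ L ⊊ K`. -/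
def IsPrimitiveField (K : IntermediateField ℚ Qbar) : Prop :=
  ∀ L : IntermediateField ℚ Qbar, L ≤ K → L = ⊥ ∨ L = K

/-! ### Projective space, varieties and curves -/

/-- The standard grading on `ℚ[x₀, …, xₙ]`. -/
abbrev polyGrading (n : ℕ) : ℕ → Submodule ℚ (MvPolynomial (Fin (n + 1)) ℚ) :=
  MvPolynomial.homogeneousSubmodule (Fin (n + 1)) ℚ

instance (n : ℕ) : GradedAlgebra (polyGrading n) := MvPolynomial.gradedAlgebra

/-- Projective `n`-space over `ℚ`, as `Proj ℚ[x₀, …, xₙ]`. -/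
def projSpace (n : ℕ) : QSch :=
  Over.mk (Proj.toSpecZero (polyGrading n) ≫
    Spec.map (CommRingCat.ofHom (algebraMap ℚ (polyGrading n 0))))

/-- The projective line over `ℚ`. -/
abbrev P1 : QSch := projSpace 1

/-- A variety over `ℚ`: an integral separated scheme of finite type over `ℚ`. -/
structure IsVariety (X : QSch) : Prop where
  isIntegral : IsIntegral X.left
  isSeparated : IsSeparated X.hom
  locallyOfFiniteType : LocallyOfFiniteType X.hom
  quasiCompact : QuasiCompact X.hom

/-- A scheme over `ℚ` is projective if it is a closed subscheme of some `ℙⁿ`. -/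
def IsProjective (X : QSch) : Prop :=
  ∃ (n : ℕ) (i : X ⟶ projSpace n), IsClosedImmersion i.left

/-- A curve over `ℚ`: a smooth projective geometrically irreducible variety of dimension `1`. -/
structure IsCurve (C : QSch) : Prop where
  isVariety : IsVariety C
  isProjective : IsProjective C
  smooth : SmoothOfRelativeDimension 1 C.hom
  geometricallyIrreducible : GeometricallyIrreducible C.hom

/-! ### Morphisms -/

/-- A morphism is constant if its image is a single point. -/
def IsConstant {X Y : QSch} (f : X ⟶ Y) : Prop := ∃ y : Y.left, ∀ x : X.left, f.left x = y

/-- The fibre `f⁻¹(b)` in `X(Qbar)` above a rational point `b`. -/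
def fibre {X Y : QSch} (f : X ⟶ Y) (b : RatPt Y) : Set (AlgPt X) := {P | P ≫ f = b.toAlgPt}

/-- `f` is unramified (`e = 1`) at the point `x`: the maximal ideal of the local ring at `f x`
generates the maximal ideal of the local ring at `x`. (Residue field extensions play no role,
as we are in characteristic `0`.) -/
def IsUnramifiedAt {X Y : QSch} (f : X ⟶ Y) (x : X.left) : Prop :=
  (IsLocalRing.maximalIdeal (Y.left.presheaf.stalk (f.left x))).map (f.left.stalkMap x).hom =
    IsLocalRing.maximalIdeal (X.left.presheaf.stalk x)

/-- `b` is a branch value of `f` if `f` is ramified at some point above `b`. -/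
def IsBranchValue {X Y : QSch} (f : X ⟶ Y) (b : RatPt Y) : Prop :=
  ∃ x : X.left, f.left x = b.pt ∧ ¬ IsUnramifiedAt f x

/-- The degree of a dominant morphism of varieties: the degree of the extension of function
fields, i.e. of the map that `f` induces on the local rings at the generic points
(a dominant `f` maps the generic point of `X` to that of `Y`).
It is `0` if this extension is infinite. -/
def degree {X Y : QSch} (hX : IsVariety X) (f : X ⟶ Y) : ℕ :=
  haveI := hX.isIntegral
  letI := (f.left.stalkMap (genericPoint X.left)).hom.toAlgebra
  Module.finrank (Y.left.presheaf.stalk (f.left (genericPoint X.left))) X.left.functionField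

/-! ### Thin sets -/

/-- Type `C₁`: contained in `Z(ℚ)` for a proper closed subset `Z` of `V`. -/
def IsThinC1 {V : QSch} (A : Set (RatPt V)) : Prop :=
  ∃ Z : Set V.left, IsClosed Z ∧ Z ≠ Set.univ ∧ ∀ a ∈ A, a.pt ∈ Z

/-- Type `C₂`: contained in `π(W(ℚ))` for a variety `W` and a dominant generically finite morphism
`π : W ⟶ V` of degree at least `2`. (As `degree` is `0` for an infinite extension of function
fields, `2 ≤ degree hW π` forces `dim W = dim V`.) -/
def IsThinC2 {V : QSch} (A : Set (RatPt V)) : Prop :=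
  ∃ (W : QSch) (hW : IsVariety W) (π : W ⟶ V),
    IsDominant π.left ∧ 2 ≤ degree hW π ∧ ∀ a ∈ A, ∃ w : RatPt W, w ≫ π = a

/-- A set of rational points is thin if it is contained in a finite union of sets of type `C₁`
or `C₂`. -/
def IsThin {V : QSch} (A : Set (RatPt V)) : Prop :=
  ∃ T : Set (Set (RatPt V)), T.Finite ∧ (∀ B ∈ T, IsThinC1 B ∨ IsThinC2 B) ∧ A ⊆ ⋃₀ T

end PrimPts

end

/-! A non-constant `f` is finite and dominant, so over an affine `U` containing `α`, with `R = Γ(U)`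
a principal ideal domain, it is given by a finite extension `R ⊆ B` with fraction fields `K ⊆ L` and
`[L : K] = d`.

At `α`: since the fibre is unramified and a single orbit, the kernel of evaluation at `P` is `𝔪B`,
where `𝔪` is the ideal of `α` (`PointsOver.ker_eq_map`). Thus `ℚ(P) ≅ B/𝔪B`, of degree `d` because
`B` is free over `R` (`finrank_adjoin_range`). A field `M` between `K` and `L` gives the ring `B ∩
M`, whose reduction at `α` is a subfield of `ℚ(P)` of degree `[M : K]`. Primitivity of `ℚ(P)`
therefore passes to `L/K` (`eq_bot_or_eq_top_of_isPrimitiveField`).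

Away from `α`: embed `L` in a finite Galois extension `N` of `K`. Each of the finitely many fields
`M ≠ K` inside `N` gives a cover of `U` of degree at least 2, the spectrum of the integral closure
of `R` in `M`. A point `β` of `U` that lifts to none of these covers has full decomposition group
(`IsGeneric.exists_conj`): on the specialization at `β`, `Gal(N/K)` and `Gal(Qbar/ℚ)` induce the
same conjugates. Hence the fibre over `β` is one orbit, and subfields of `ℚ(Q)` are controlled by
intermediate fields of `L/K` (`isPrimitiveField_of_conj`, `IsGeneric.pointsOver`). So `ℚ(Q)` is
primitive, and it is either `ℚ` or of degree `d`. The first case with `d ≥ 2` makes `β` the image of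
a rational point of `C`, which is again a thin condition. -/

noncomputable section

namespace PrimPts

open IsLocalRing (closedPoint maximalIdeal)

/-! ### Specializations of a Galois extension -/

section Invariant

variable {R A G : Type*} [CommRing R] [CommRing A] [Algebra R A] [Group G] [Finite G]
  [MulSemiringAction G A] [Algebra.IsInvariant R A G]

/-- Two homomorphisms to a field which agree on the ring of invariants are conjugate, also if one
of them is only defined on a subring. -/
theorem exists_smul_of_comp_eq {B F : Type*} [CommRing B] [Algebra ℚ B] [Algebra R B] [Field F]
    [CharZero F] (j : B →ₐ[R] A) (hj : Function.Injective j) (ψ : A →+* F) (φ : B →+* F)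
    (h : φ.comp (algebraMap R B) = ψ.comp (algebraMap R A)) :
    ∃ σ : G, ∀ b, φ b = ψ (σ • j b) := by
  have := Fintype.ofFinite G
  let p : G → Subspace ℚ B := fun σ =>
    LinearMap.ker ((φ.toAddMonoidHom -
      (ψ.comp ((MulSemiringAction.toRingHom G A σ).comp (j : B →+* A))).toAddMonoidHom).toRatLinearMap)
  have hp : ∀ σ b, b ∈ p σ ↔ φ b = ψ (σ • j b) := fun σ b => by
    rw [← sub_eq_zero]; rfl
  -- The characteristic polynomial of `j b` has coefficients in `R`, so `φ b` is a root of its image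
  -- under `ψ`, and some `σ` works for this `b`. The elements for which a given `σ` works form a
  -- `ℚ`-subspace. Finitely many proper subspaces cannot cover a space over an infinite field, so
  -- one `σ` works for all `b`.
  have hc : ⋃ σ, (p σ : Set B) = Set.univ := by
    refine Set.eq_univ_of_forall fun b => Set.mem_iUnion.2 ?_
    simp only [SetLike.mem_coe, hp]
    obtain ⟨q, hq⟩ := (Polynomial.mem_lifts _).mp
      (Algebra.IsInvariant.charpoly_mem_lifts R A G (j b))
    have h1 : Polynomial.aeval b q = 0 := by
      apply hj
      rw [← Polynomial.aeval_algHom_apply, map_zero, Polynomial.aeval_def, ← Polynomial.eval_map,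
        hq, MulSemiringAction.eval_charpoly]
    have h2 : Polynomial.eval (φ b) ((MulSemiringAction.charpoly G (j b)).map ψ) = 0 := by
      rw [← hq, Polynomial.map_map, ← h, ← Polynomial.map_map, Polynomial.eval_map,
        Polynomial.eval₂_at_apply, Polynomial.eval_map, ← Polynomial.aeval_def, h1, map_zero]
    rw [MulSemiringAction.charpoly_eq, Polynomial.map_prod, Polynomial.eval_prod,
      Finset.prod_eq_zero_iff] at h2
    obtain ⟨σ, -, hσ⟩ := h2
    refine ⟨σ, ?_⟩
    simpa [sub_eq_zero] using hσ
  obtain ⟨σ, hσ⟩ := Subspace.exists_eq_top_of_iUnion_eq_univ hc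
  exact ⟨σ, fun b => (hp σ b).1 (hσ ▸ Submodule.mem_top)⟩

end Invariant

/-- A homomorphism to an algebraically closed field extends along an integral extension. -/
theorem exists_comp_algebraMap_eq {R A F : Type*} [CommRing R] [CommRing A] [IsDomain A]
    [Algebra R A] [Algebra.IsIntegral R A] [Field F] [IsAlgClosed F] (hRA : Function.Injective (algebraMap R A))
    (b : R →+* F) : ∃ ψ : A →+* F, ψ.comp (algebraMap R A) = b := by
  let p := RingHom.ker b
  have : p.IsPrime := RingHom.ker_isPrime b
  obtain ⟨P, hP, hPp⟩ := Ideal.exists_ideal_over_prime_of_isIntegral_of_isDomain (S := A) p (by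
    rw [(RingHom.injective_iff_ker_eq_bot _).1 hRA]; exact bot_le)
  have : P.LiesOver p := ⟨hPp.symm⟩
  let bp : R ⧸ p →+* F := Ideal.Quotient.lift p b fun _ h => h
  have hbp : Function.Injective bp := RingHom.kerLift_injective b
  let := bp.toAlgebra
  have : Module.IsTorsionFree (R ⧸ p) F := Module.isTorsionFree_iff_algebraMap_injective.2 hbp
  have : Module.IsTorsionFree (R ⧸ p) (A ⧸ P) := Module.isTorsionFree_iff_algebraMap_injective.2
    (FaithfulSMul.algebraMap_injective _ _)
  let e : (A ⧸ P) →ₐ[R ⧸ p] F := IsAlgClosed.lift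
  exact ⟨(e : A ⧸ P →+* F).comp (Ideal.Quotient.mk P),
    RingHom.ext fun r => e.commutes (Ideal.Quotient.mk p r)⟩

instance : IsAlgClosure ℚ Qbar := by
  -- `Qbar` has two `ℚ`-algebra structures, one as a field of characteristic zero and one as an
  -- algebraic closure; they are equal.
  rw [Subsingleton.elim (DivisionRing.toRatAlgebra : Algebra ℚ Qbar)
    (AlgebraicClosure.instAlgebra ℚ)]
  infer_instance

instance : IsGalois ℚ Qbar := IsAlgClosure.isGalois ℚ Qbar

section Galois

variable {R K N A : Type*} [CommRing R] [Field K] [Field N] [CommRing A]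
  [Algebra R K] [Algebra K N] [Algebra R N] [IsScalarTower R K N]
  [Algebra R A] [Algebra A N] [IsScalarTower R A N] 
  [MulSemiringAction (N ≃ₐ[K] N) A]
  [Algebra.IsInvariant R A (N ≃ₐ[K] N)]

/-- `b : R → ℚ` does not extend to the integral closure of `R` in any proper extension of `K`
inside `N`. -/
def IsGeneric (R K N : Type*) [CommRing R] [Field K] [Field N] 
  [Algebra R K] [Algebra K N] [Algebra R N] [IsScalarTower R K N] (b : R →+* ℚ) : Prop :=
  ∀ M : IntermediateField K N, M ≠ ⊥ →
    ∀ c : integralClosure R M →+* ℚ, c.comp (algebraMap R (integralClosure R M)) ≠ b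

/-- The decomposition group `D` of `ψ` is everything. On integral elements of its fixed field `M`
the values of `ψ` are Galois invariant, hence rational, so `b` extends to the integral closure of
`R` in `M`; genericity then forces `M = K`. -/
theorem IsGeneric.exists_conj [FiniteDimensional K N] [IsIntegralClosure A R N] {b : R →+* ℚ} (hb : IsGeneric R K N b)
    [Algebra ℚ A]
    (hA : ∀ (σ : N ≃ₐ[K] N) (a : A), algebraMap A N (σ • a) = σ (algebraMap A N a))
    {ψ : A →+* Qbar} (hψ : ψ.comp (algebraMap R A) = (algebraMap ℚ Qbar).comp b)
    (σ : N ≃ₐ[K] N) : ∃ τ : Qbar ≃ₐ[ℚ] Qbar, ∀ a, ψ (σ • a) = τ (ψ a) := by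
  let D : Subgroup (N ≃ₐ[K] N) :=
    { carrier := {σ | ∃ τ : Qbar ≃ₐ[ℚ] Qbar, ∀ a, ψ (σ • a) = τ (ψ a)}
      one_mem' := ⟨1, fun a => by simp⟩
      mul_mem' := by
        rintro σ σ' ⟨τ, h⟩ ⟨τ', h'⟩
        exact ⟨τ * τ', fun a => by rw [mul_smul, h, h', AlgEquiv.mul_apply]⟩
      inv_mem' := by
        rintro σ ⟨τ, h⟩
        refine ⟨τ⁻¹, fun a => τ.injective ?_⟩
        rw [← h, smul_inv_smul, ← AlgEquiv.mul_apply, mul_inv_cancel, AlgEquiv.one_apply] }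
  suffices hD : D = ⊤ from (hD ▸ Subgroup.mem_top σ : σ ∈ D)
  by_contra hD
  let M := IntermediateField.fixedField D
  have hM : M ≠ ⊥ := fun h => hD <| by
    rw [← IntermediateField.fixingSubgroup_fixedField D, show IntermediateField.fixedField D = ⊥
      from h, IntermediateField.fixingSubgroup_bot]
  have : IsScalarTower R (integralClosure R M) N := IsScalarTower.of_algebraMap_eq fun r => by
    rw [IsScalarTower.algebraMap_apply R K N, IsScalarTower.algebraMap_apply K M N,
      ← IsScalarTower.algebraMap_apply R K M]; rfl
  let l : integralClosure R M →ₐ[R] A := IsIntegralClosure.lift R A N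
  have hl : ∀ x, algebraMap A N (l x) = (x : M) := fun x => IsIntegralClosure.algebraMap_lift R A N x
  have hfix : ∀ σ ∈ D, ∀ x, σ • l x = l x := fun σ hσ x => by
    apply IsIntegralClosure.algebraMap_injective A R N
    rw [hA, hl]
    exact (x : M).2 ⟨σ, hσ⟩
  have hrat : ∀ x, ψ (l x) ∈ (⊥ : IntermediateField ℚ Qbar) := fun x => by
    rw [← InfiniteGalois.fixedField_bot]
    rintro ⟨τ, -⟩
    obtain ⟨σ, hσ⟩ := exists_smul_of_comp_eq (G := N ≃ₐ[K] N) (AlgHom.id R A)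
      Function.injective_id ψ ((τ : Qbar →+* Qbar).comp ψ) (by
        rw [RingHom.comp_assoc, hψ, ← RingHom.comp_assoc]
        congr 1
        exact τ.toAlgHom.comp_algebraMap)
    have hσD : σ ∈ D := ⟨τ, fun a => (hσ a).symm⟩
    have := hσ (l x)
    rw [AlgHom.id_apply, hfix σ hσD] at this
    exact this
  let c : integralClosure R M →+* ℚ :=
    (IntermediateField.botEquiv ℚ Qbar : (⊥ : IntermediateField ℚ Qbar) →+* ℚ).comp
      ((ψ.comp (l : integralClosure R M →+* A)).codRestrict
        (⊥ : IntermediateField ℚ Qbar) hrat)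
  refine hb M hM c ?_
  ext r
  apply (algebraMap ℚ Qbar).injective
  have h1 := congr($hψ r)
  simp only [RingHom.comp_apply] at h1
  rw [← h1]
  have h2 : ∀ y : (⊥ : IntermediateField ℚ Qbar),
      algebraMap ℚ Qbar (IntermediateField.botEquiv ℚ Qbar y) = y := fun y => by
    obtain ⟨q, rfl⟩ := (IntermediateField.botEquiv ℚ Qbar).symm.surjective y
    simp
  refine (h2 _).trans ?_
  change ψ (l (algebraMap R _ r)) = _
  rw [AlgHom.commutes]

end Galois

/-- Automorphisms of `Qbar` that agree on a set agree on the field it generates. -/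
theorem eq_on_adjoin {S : Set Qbar} {τ τ' : Qbar ≃ₐ[ℚ] Qbar} (h : ∀ x ∈ S, τ x = τ' x)
    {E : IntermediateField ℚ Qbar} (hE : E ≤ IntermediateField.adjoin ℚ S) {x : Qbar}
    (hx : x ∈ E) : τ x = τ' x := by
  have h1 : IntermediateField.adjoin ℚ S ≤ IntermediateField.fixedField
      (Subgroup.zpowers (τ'⁻¹ * τ)) := by
    rw [IntermediateField.adjoin_le_iff]
    intro y hy
    rw [SetLike.mem_coe, IntermediateField.mem_fixedField_iff]
    intro g hg
    have : Subgroup.zpowers (τ'⁻¹ * τ) ≤ MulAction.stabilizer (Qbar ≃ₐ[ℚ] Qbar) y := by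
      rw [Subgroup.zpowers_le, MulAction.mem_stabilizer_iff, mul_smul, inv_smul_eq_iff]
      exact h y hy
    exact this hg
  have h2 := (IntermediateField.mem_fixedField_iff _ _).1 (h1 (hE hx)) _
    (Subgroup.mem_zpowers (τ'⁻¹ * τ))
  have h3 : τ'⁻¹ • τ • x = x := by rw [← mul_smul]; exact h2
  exact inv_smul_eq_iff.1 h3

/-! ### Comparing subfields of the specialization with intermediate fields of `N/K` -/

section Correspondence

variable {K N A B : Type*} [Field K] [Field N] [Algebra K N] [FiniteDimensional K N] [IsGalois K N]
  [CommRing A] [MulSemiringAction (N ≃ₐ[K] N) A] [CommRing B]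

/-- The fields generated by the values of a homomorphism whose Galois conjugates over `K` and
over `ℚ` are the same. -/
theorem isPrimitiveField_of_conj (j : B →+* A) (ψ : A →+* Qbar)
    (h₁ : ∀ σ : N ≃ₐ[K] N, ∃ τ : Qbar ≃ₐ[ℚ] Qbar, ∀ a, ψ (σ • a) = τ (ψ a))
    (h₂ : ∀ τ : Qbar ≃ₐ[ℚ] Qbar, ∃ σ : N ≃ₐ[K] N, ∀ a, ψ (σ • a) = τ (ψ a))
    (L : IntermediateField K N) (hL : ∀ M ≤ L, M = ⊥ ∨ M = L)
    (hj : ∀ σ ∈ L.fixingSubgroup, ∀ b, σ • j b = j b) :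
    IsPrimitiveField (IntermediateField.adjoin ℚ (Set.range (ψ.comp j))) ∧
    (IntermediateField.adjoin ℚ (Set.range (ψ.comp j)) = ⊥ ∨
      Module.finrank ℚ (IntermediateField.adjoin ℚ (Set.range (ψ.comp j))) =
        Module.finrank K L) := by
  set E₀ := IntermediateField.adjoin ℚ (Set.range (ψ.comp j)) with hE₀
  -- `T` consists of the pairs with the same effect through `ψ`. It surjects onto both Galois
  -- groups, so subgroups of either can be compared by their preimages in `T`.
  let T : Subgroup ((N ≃ₐ[K] N) × (Qbar ≃ₐ[ℚ] Qbar)) :=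
    { carrier := {g | ∀ a, ψ (g.1 • a) = g.2 (ψ a)}
      one_mem' := fun a => by simp
      mul_mem' := fun {g g'} h h' a => by
        rw [Prod.fst_mul, Prod.snd_mul, mul_smul, h, h', AlgEquiv.mul_apply]
      inv_mem' := fun {g} h a => g.2.injective <| by
        rw [← h, Prod.fst_inv, smul_inv_smul, Prod.snd_inv, ← AlgEquiv.mul_apply,
          mul_inv_cancel, AlgEquiv.one_apply] }
  let p₁ : T →* (N ≃ₐ[K] N) := (MonoidHom.fst _ _).comp T.subtype
  let p₂ : T →* (Qbar ≃ₐ[ℚ] Qbar) := (MonoidHom.snd _ _).comp T.subtype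
  have hp₁ : Function.Surjective p₁ := fun σ => (h₁ σ).elim fun τ h => ⟨⟨(σ, τ), h⟩, rfl⟩
  have hp₂ : Function.Surjective p₂ := fun τ => (h₂ τ).elim fun σ h => ⟨⟨(σ, τ), h⟩, rfl⟩
  have key : ∀ E ≤ E₀, ∃ H : Subgroup (N ≃ₐ[K] N), L.fixingSubgroup ≤ H ∧
      H.comap p₁ = E.fixingSubgroup.comap p₂ := by
    intro E hE
    refine ⟨(E.fixingSubgroup.comap p₂).map p₁, fun σ hσ => ?_, ?_⟩
    · obtain ⟨t, rfl⟩ := hp₁ σ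
      refine ⟨t, fun x => ?_, rfl⟩
      refine (eq_on_adjoin (τ' := 1) ?_ hE x.2 :)
      rintro _ ⟨b, rfl⟩
      exact (t.2 (j b)).symm.trans congr(ψ $(hj _ hσ b))
    -- Two elements of `T` with the same first component act alike on the values of `ψ`, hence on `E
    -- ≤ E₀`; so the preimage of `Gal(Qbar/E)` is saturated for `p₁`.
    · refine le_antisymm (fun t ht => ?_) (Subgroup.le_comap_map _ _)
      obtain ⟨t', ht', h⟩ := ht
      intro x
      refine ((eq_on_adjoin (τ' := p₂ t') ?_ hE x.2 :)).trans (ht' x)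
      rintro _ ⟨b, rfl⟩
      exact (t.2 (j b)).symm.trans (congr(ψ ($h.symm • j b)).trans (t'.2 (j b)))
  -- The alternative `⊥` cannot be dropped even for `E₀`: values of `ψ` may coincide where elements
  -- of `N` differ, so `E₀` may collapse to `ℚ`.
  have key2 : ∀ E ≤ E₀, E = ⊥ ∨ L.fixingSubgroup.comap p₁ = E.fixingSubgroup.comap p₂ := by
    intro E hE
    obtain ⟨H, hLH, h⟩ := key E hE
    have hM : IntermediateField.fixedField H ≤ L := by
      rw [← IsGalois.fixedField_fixingSubgroup L]
      exact IntermediateField.fixedField_antitone hLH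
    rcases hL _ hM with hM | hM
    · left
      have hH : H = ⊤ := by
        rw [← IntermediateField.fixingSubgroup_fixedField H, hM,
          IntermediateField.fixingSubgroup_bot]
      rw [hH, Subgroup.comap_top] at h
      have : E.fixingSubgroup = ⊤ := top_unique fun τ _ => by
        obtain ⟨t, rfl⟩ := hp₂ τ
        exact (h ▸ Subgroup.mem_top t : t ∈ E.fixingSubgroup.comap p₂)
      rw [← InfiniteGalois.fixedField_fixingSubgroup E, this, InfiniteGalois.fixedField_bot]
    · right
      rw [← h, ← IntermediateField.fixingSubgroup_fixedField H, hM]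
  refine ⟨fun E hE => ?_, ?_⟩
  · refine (key2 E hE).imp_right fun h => le_antisymm hE ?_
    rw [← InfiniteGalois.fixedField_fixingSubgroup E, hE₀, IntermediateField.adjoin_le_iff]
    rintro _ ⟨b, rfl⟩
    rintro ⟨τ, hτ⟩
    obtain ⟨t, rfl⟩ := hp₂ τ
    have ht : p₁ t ∈ L.fixingSubgroup := by
      change t ∈ L.fixingSubgroup.comap p₁
      rw [h]; exact hτ
    exact (t.2 (j b)).symm.trans congr(ψ $(hj _ ht b))
  · refine (key2 E₀ le_rfl).imp_right fun h => ?_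
    -- Both degrees equal the index of the common preimage in `T`.
    rw [IntermediateField.finrank_eq_fixingSubgroup_index,
      IntermediateField.finrank_eq_fixingSubgroup_index,
      ← Subgroup.index_comap_of_surjective _ hp₁, h, Subgroup.index_comap_of_surjective _ hp₂]

end Correspondence

/-! ### Fibres over generic rational points, in terms of coordinate rings -/

section Fibres

/-- The points above `b` in terms of coordinate rings: homomorphisms `φ : B → Qbar` that extend
`b : R → ℚ`. -/
def PointsOver {R B : Type*} [CommRing R] [CommRing B] [Algebra R B] (b : R →+* ℚ) :
    Set (B →+* Qbar) :=
  {φ | φ.comp (algebraMap R B) = (algebraMap ℚ Qbar).comp b}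

variable {R B K N : Type*} [CommRing R] [IsDomain R] [IsIntegrallyClosed R] [Algebra ℚ R]
  [CommRing B] [IsDomain B] [Algebra ℚ B] [Algebra R B] [Algebra.IsIntegral R B]
  [Field K] [Algebra R K] [IsFractionRing R K]
  [Field N] [Algebra K N] [Algebra R N] [IsScalarTower R K N] [FiniteDimensional K N]
  [IsGalois K N] [Algebra B N] [IsScalarTower R B N]

-- Extend `b` to one homomorphism `ψ` on the integral closure `A` of `R` in `N`. Every point of `B`
-- over `b` has the form `ψ ∘ σ ∘ j`, and by genericity `ψ ∘ σ` is a conjugate of `ψ` over `ℚ`; this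
-- gives transitivity. The fields come from `isPrimitiveField_of_conj` applied to `ψ ∘ σ`.
omit [IsDomain B] in
theorem IsGeneric.pointsOver (hBN : Function.Injective (algebraMap B N))
    (L : IntermediateField K N) (hBL : ∀ b, algebraMap B N b ∈ L)
    (hL : ∀ M ≤ L, M = ⊥ ∨ M = L) {b : R →+* ℚ} (hb : IsGeneric R K N b) :
    (∃ φ : B →+* Qbar, φ ∈ PointsOver b) ∧
    (∀ φ ∈ PointsOver b, ∀ φ' ∈ PointsOver b,
      ∃ τ : Qbar ≃ₐ[ℚ] Qbar, φ' = (τ : Qbar →+* Qbar).comp (φ : B →+* Qbar)) ∧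
    ∀ φ ∈ PointsOver b,
      IsPrimitiveField (IntermediateField.adjoin ℚ (Set.range (φ : B →+* Qbar))) ∧
      (IntermediateField.adjoin ℚ (Set.range φ) = ⊥ ∨
        Module.finrank ℚ (IntermediateField.adjoin ℚ (Set.range φ)) = Module.finrank K L) := by
  let A := integralClosure R N
  have : IsFractionRing A N := IsIntegralClosure.isFractionRing_of_finite_extension R K N A
  let : MulSemiringAction (N ≃ₐ[K] N) A := IsIntegralClosure.MulSemiringAction R K N A
  have : Algebra.IsInvariant R A (N ≃ₐ[K] N) := Algebra.isInvariant_of_isGalois R K N A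
  have hA : ∀ (σ : N ≃ₐ[K] N) (a : A), algebraMap A N (σ • a) = σ (algebraMap A N a) :=
    fun σ a => algebraMap_galRestrict_apply R σ a
  have : SMulCommClass (N ≃ₐ[K] N) R A := ⟨fun σ r a => by
    apply IsIntegralClosure.algebraMap_injective A R N
    rw [hA, Algebra.smul_def, Algebra.smul_def, map_mul, map_mul, map_mul, hA,
      ← IsScalarTower.algebraMap_apply R A N, IsScalarTower.algebraMap_apply R K N, σ.commutes]⟩
  let : Algebra ℚ A := ((algebraMap R A).comp (algebraMap ℚ R)).toAlgebra
  let j : B →ₐ[R] A := IsIntegralClosure.lift R A N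
  have hjN : ∀ x, algebraMap A N (j x) = algebraMap B N x := fun x =>
    IsIntegralClosure.algebraMap_lift R A N x
  have hj : Function.Injective j := fun x y h => hBN <| by rw [← hjN, h, hjN]
  have hRA : Function.Injective (algebraMap R A) := fun x y h => by
    refine FaithfulSMul.algebraMap_injective R K ((algebraMap K N).injective ?_)
    rw [← IsScalarTower.algebraMap_apply, ← IsScalarTower.algebraMap_apply,
      IsScalarTower.algebraMap_apply R A N, h, ← IsScalarTower.algebraMap_apply]
  obtain ⟨ψ, hψ⟩ := exists_comp_algebraMap_eq hRA ((algebraMap ℚ Qbar).comp b)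
  have h₁ : ∀ ψ : A →+* Qbar, ψ.comp (algebraMap R A) = (algebraMap ℚ Qbar).comp b →
      ∀ σ : N ≃ₐ[K] N, ∃ τ : Qbar ≃ₐ[ℚ] Qbar, ∀ a, ψ (σ • a) = τ (ψ a) :=
    fun ψ hψ => hb.exists_conj hA hψ
  have h₂ : ∀ ψ : A →+* Qbar, ψ.comp (algebraMap R A) = (algebraMap ℚ Qbar).comp b →
      ∀ τ : Qbar ≃ₐ[ℚ] Qbar, ∃ σ : N ≃ₐ[K] N, ∀ a, ψ (σ • a) = τ (ψ a) := fun ψ hψ τ => by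
    obtain ⟨σ, hσ⟩ := exists_smul_of_comp_eq (G := N ≃ₐ[K] N) (AlgHom.id R A)
      Function.injective_id ψ ((τ : Qbar →+* Qbar).comp ψ) (by
        rw [RingHom.comp_assoc, hψ, ← RingHom.comp_assoc]
        congr 1
        exact τ.toAlgHom.comp_algebraMap)
    exact ⟨σ, fun a => (hσ a).symm⟩
  have hext : ∀ φ ∈ PointsOver b, ∃ σ : N ≃ₐ[K] N, ∀ x, φ x = ψ (σ • j x) := fun φ hφ =>
    exists_smul_of_comp_eq j hj ψ φ (hφ.trans hψ.symm)
  refine ⟨⟨ψ.comp j, ?_⟩, fun φ hφ φ' hφ' => ?_, fun φ hφ => ?_⟩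
  · change (ψ.comp (j : B →+* A)).comp _ = _
    rw [RingHom.comp_assoc, j.comp_algebraMap, hψ]
  · obtain ⟨σ, hσ⟩ := hext φ hφ
    obtain ⟨σ', hσ'⟩ := hext φ' hφ'
    obtain ⟨τ, hτ⟩ := h₁ ψ hψ σ
    obtain ⟨τ', hτ'⟩ := h₁ ψ hψ σ'
    refine ⟨τ' * τ⁻¹, RingHom.ext fun x => ?_⟩
    rw [RingHom.comp_apply, RingHom.coe_coe, hσ', hτ', hσ, hτ, ← AlgEquiv.mul_apply,
      inv_mul_cancel_right]
  · obtain ⟨σ, hσ⟩ := hext φ hφ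
    let ψ' : A →+* Qbar := ψ.comp (MulSemiringAction.toRingHom _ A σ)
    have hψ' : ψ'.comp (algebraMap R A) = (algebraMap ℚ Qbar).comp b := by
      rw [← hψ, RingHom.comp_assoc]
      congr 1
      ext r
      exact congr((algebraMap A N) $(smul_algebraMap σ r))
    have hφψ : φ = ψ'.comp (j : B →+* A) := RingHom.ext hσ
    have := isPrimitiveField_of_conj (j : B →+* A) ψ' (h₁ ψ' hψ') (h₂ ψ' hψ') L hL fun σ hσ x => by
      apply IsIntegralClosure.algebraMap_injective A R N
      rw [hA]
      exact (congr(σ $(hjN x))).trans ((hσ ⟨_, hBL x⟩).trans (hjN x).symm)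
    rw [hφψ]
    exact this

end Fibres

/-! ### Passing primitivity from an unramified, inert fibre to the function fields -/

section Unramified

variable {R B K L : Type*} [CommRing R] [IsDomain R] [IsPrincipalIdealRing R]
  [CommRing B] [IsDomain B] [Algebra R B] [Module.Finite R B] [FaithfulSMul R B]
  [Field K] [Algebra R K] [IsFractionRing R K]
  [Field L] [Algebra B L] [IsFractionRing B L] [Algebra K L] [Algebra R L] [IsScalarTower R K L]
  [IsScalarTower R B L]

-- `B / ker φ` is integral over the field `R / ker b`, so it is already a field and no division is
-- needed to generate the field of values.
omit [IsPrincipalIdealRing R] [IsDomain R] [IsDomain B] [FaithfulSMul R B] in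
theorem PointsOver.exists_quotientEquiv {b : R →+* ℚ} (hbs : Function.Surjective b)
    {φ : B →+* Qbar} (hφ : φ ∈ PointsOver b) :
    ∃ e : (B ⧸ RingHom.ker φ) ≃+* IntermediateField.adjoin ℚ (Set.range φ),
      ∀ x, (e (Ideal.Quotient.mk _ x) : Qbar) = φ x := by
  have hm : (RingHom.ker b).IsMaximal := RingHom.ker_isMaximal_of_surjective b hbs
  have := RingHom.ker_isPrime φ
  have hq : (RingHom.ker φ).IsMaximal := by
    refine Ideal.isMaximal_of_isIntegral_of_isMaximal_comap (R := R) (RingHom.ker φ) ?_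
    rwa [RingHom.comap_ker, show φ.comp (algebraMap R B) = _ from hφ,
      RingHom.ker_comp_of_injective _ (algebraMap ℚ Qbar).injective]
  let := Ideal.Quotient.field (RingHom.ker φ)
  let g : (B ⧸ RingHom.ker φ) →+* Qbar := RingHom.kerLift φ
  let E : IntermediateField ℚ Qbar :=
    { g.fieldRange with
      algebraMap_mem' := fun q => by
        rw [eq_ratCast]
        exact SubfieldClass.ratCast_mem g.fieldRange q
      inv_mem' := g.fieldRange.inv_mem' }
  have hE : IntermediateField.adjoin ℚ (Set.range φ) ≤ E := by
    rw [IntermediateField.adjoin_le_iff]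
    rintro _ ⟨x, rfl⟩
    exact ⟨Ideal.Quotient.mk _ x, rfl⟩
  have hmem : ∀ y, g y ∈ IntermediateField.adjoin ℚ (Set.range φ) := fun y => by
    obtain ⟨x, rfl⟩ := Ideal.Quotient.mk_surjective y
    exact IntermediateField.subset_adjoin _ _ ⟨x, rfl⟩
  refine ⟨RingEquiv.ofBijective (g.codRestrict _ hmem) ⟨fun x y h => ?_, fun y => ?_⟩, fun x => rfl⟩
  · exact g.injective congr(($h : Qbar))
  · obtain ⟨x, hx⟩ := hE y.2
    exact ⟨x, Subtype.ext hx⟩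

-- The field of values is `B/𝔪B` with `𝔪 = ker b`, and its dimension over `R/𝔪 = ℚ` is the rank of
-- `B` over `R`.
omit [FaithfulSMul R B] in
include K L in
theorem finrank_adjoin_range {b : R →+* ℚ} (hbs : Function.Surjective b) {φ : B →+* Qbar}
    (hφ : φ ∈ PointsOver b)
    (hker : RingHom.ker φ = (RingHom.ker b).map (algebraMap R B)) :
    Module.finrank ℚ (IntermediateField.adjoin ℚ (Set.range φ)) = Module.finrank K L := by
  have : (RingHom.ker b).IsMaximal := RingHom.ker_isMaximal_of_surjective b hbs
  rw [← Ideal.finrank_quotient_map (S := B) (RingHom.ker b) K L]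
  obtain ⟨e, he⟩ := PointsOver.exists_quotientEquiv hbs hφ
  symm
  refine Algebra.finrank_eq_of_equiv_equiv (RingHom.quotientKerEquivOfSurjective hbs)
    ((Ideal.quotEquivOfEq hker.symm).trans e) ?_
  ext r
  exact ((he _).trans congr($hφ r)).symm

/-- The ring `B' = B ∩ M` has fraction field `M` and inherits the hypothesis on the kernel. Its
field of values is then a subfield of that of `B` of degree `[M : K]`, and primitivity leaves only
the degrees `1` and `[L : K]`. -/
theorem eq_bot_or_eq_top_of_isPrimitiveField [FiniteDimensional K L] {b : R →+* ℚ} (hbs : Function.Surjective b)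
    {φ : B →+* Qbar} (hφ : φ ∈ PointsOver b)
    (hker : RingHom.ker φ = (RingHom.ker b).map (algebraMap R B))
    (hprim : IsPrimitiveField (IntermediateField.adjoin ℚ (Set.range φ)))
    (M : IntermediateField K L) : M = ⊥ ∨ M = ⊤ := by
  let B' : Subalgebra R B := (M.toSubalgebra.restrictScalars R).comap (IsScalarTower.toAlgHom R B L)
  have hB' : ∀ x : B, x ∈ B' ↔ algebraMap B L x ∈ M := fun x => Iff.rfl
  have : Module.Finite R B' := inferInstanceAs (Module.Finite R (Subalgebra.toSubmodule B'))
  let ι : B' →+* M := ((algebraMap B L).comp B'.val.toRingHom).codRestrict M fun x => x.2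
  let : Algebra B' M := ι.toAlgebra
  have hBM : ∀ x : B', (algebraMap B' M x : L) = algebraMap B L x := fun x => rfl
  have : IsScalarTower R B' M := IsScalarTower.of_algebraMap_eq fun r => by
    apply Subtype.ext
    rw [hBM, Subalgebra.coe_algebraMap, ← IsScalarTower.algebraMap_apply,
      IsScalarTower.algebraMap_apply R K L, IsScalarTower.algebraMap_apply R K M]
    rfl
  have : FaithfulSMul R B' := (faithfulSMul_iff_algebraMap_injective R B').2 fun x y h =>
    FaithfulSMul.algebraMap_injective R B congr(($h : B))
  have hιi : Function.Injective (algebraMap B' M) := fun x y h =>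
    Subtype.ext (IsFractionRing.injective B L congr(($h : L)))
  have : IsFractionRing B' M := by
    have : FaithfulSMul B' M := (faithfulSMul_iff_algebraMap_injective B' M).2 hιi
    refine IsFractionRing.of_field B' M fun z => ?_
    obtain ⟨x, s, hs, hz⟩ := IsFractionRing.div_surjective (A := B) (z : L)
    -- A denominator in `B` divides a nonzero element of `R`. With denominator `r ∈ R ⊆ M`, the
    -- numerator `z * r` lies in `M` as well as in `B`.
    obtain ⟨r, hr, c, hc⟩ := (Algebra.IsIntegral.isIntegral (R := R) s).isAlgebraic.exists_nonzero_dvd hs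
    have hr' : algebraMap R L r ≠ 0 := by
      rw [IsScalarTower.algebraMap_apply R B L, map_ne_zero_iff _ (IsFractionRing.injective B L),
        map_ne_zero_iff _ (FaithfulSMul.algebraMap_injective R B)]
      exact hr
    have hs' : algebraMap B L s ≠ 0 := IsFractionRing.to_map_ne_zero_of_mem_nonZeroDivisors hs
    have hxc : (z : L) * algebraMap R L r = algebraMap B L (x * c) := by
      rw [IsScalarTower.algebraMap_apply R B L, hc, ← hz]
      simp only [map_mul]
      field_simp
    refine ⟨⟨x * c, ?_⟩, algebraMap R B' r, Subtype.ext ?_⟩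
    · rw [hB', ← hxc]
      exact mul_mem z.2 (algebraMap R M r).2
    · change (z : L) = algebraMap B L (x * c) / algebraMap B L (algebraMap R B r)
      rw [← IsScalarTower.algebraMap_apply, ← hxc, mul_div_cancel_right₀ _ hr']
  let φ' : B' →+* Qbar := φ.comp B'.val.toRingHom
  have hφ' : φ' ∈ PointsOver b := hφ
  have hker' : RingHom.ker φ' = (RingHom.ker b).map (algebraMap R B') := by
    -- With a generator `π` of `ker b`, an element of `B'` divisible by `π` in `B` has its quotient
    -- in `B ∩ M = B'`. The value `π = 0` is possible when `b` is injective and is treated apart.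
    obtain ⟨π, hπ⟩ := IsPrincipalIdealRing.principal (RingHom.ker b)
    rw [Ideal.submodule_span_eq] at hπ
    rw [hπ, Ideal.map_span, Set.image_singleton] at hker ⊢
    ext x
    rw [RingHom.mem_ker, Ideal.mem_span_singleton]
    change x.1 ∈ RingHom.ker φ ↔ _
    rw [hker, Ideal.mem_span_singleton]
    constructor
    · rintro ⟨y, hy⟩
      rcases eq_or_ne π 0 with rfl | hπ0
      · rw [map_zero, zero_mul] at hy
        rw [map_zero, zero_dvd_iff]
        exact Subtype.ext hy
      refine ⟨⟨y, ?_⟩, Subtype.ext hy⟩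
      have hπ' : algebraMap R L π ≠ 0 := by
        rw [IsScalarTower.algebraMap_apply R B L, map_ne_zero_iff _ (IsFractionRing.injective B L),
          map_ne_zero_iff _ (FaithfulSMul.algebraMap_injective R B)]
        exact hπ0
      have : algebraMap B L y = algebraMap B L x.1 / algebraMap R L π := by
        rw [eq_div_iff hπ', hy, map_mul, ← IsScalarTower.algebraMap_apply, mul_comm]
      rw [hB', this]
      exact div_mem x.2 (algebraMap R M π).2
    · rintro ⟨y, hy⟩
      exact ⟨y.1, congr(($hy : B))⟩
  have h1 := finrank_adjoin_range (K := K) (L := L) hbs hφ hker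
  have h2 := finrank_adjoin_range (K := K) (L := M) hbs hφ' hker'
  have hle : IntermediateField.adjoin ℚ (Set.range φ') ≤ IntermediateField.adjoin ℚ (Set.range φ) :=
    IntermediateField.adjoin.mono _ _ _ (by rintro _ ⟨x, rfl⟩; exact ⟨x, rfl⟩)
  rcases hprim _ hle with h | h
  · left
    rw [h, IntermediateField.finrank_bot] at h2
    exact IntermediateField.finrank_eq_one_iff.1 h2.symm
  · right
    rw [h, h1] at h2
    exact IntermediateField.eq_of_le_of_finrank_eq le_top (by rw [← h2, IntermediateField.finrank_top'])

end Unramified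

/-! ### Field-valued points as evaluation homomorphisms on affine opens -/

section EvalAt

variable {F : Type} [Field F] {X Y : Scheme.{0}}

/-- Evaluation of functions at a field-valued point. -/
def evalAt (g : Spec (.of F) ⟶ X) {V : X.Opens} (h : g (closedPoint F) ∈ V) : Γ(X, V) →+* F :=
  (X.presheaf.germ V _ h ≫ Scheme.stalkClosedPointTo g).hom

theorem SpecMap_evalAt (g : Spec (.of F) ⟶ X) {V : X.Opens} (hV : IsAffineOpen V)
    (h : g (closedPoint F) ∈ V) : Spec.map (CommRingCat.ofHom (evalAt g h)) ≫ hV.fromSpec = g := by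
  have h1 := hV.fromSpecStalk_eq_fromSpecStalk h
  rw [IsAffineOpen.fromSpecStalk] at h1
  rw [evalAt, CommRingCat.ofHom_hom, Spec.map_comp, Category.assoc, h1,
    Scheme.Spec_stalkClosedPointTo_fromSpecStalk]

theorem eq_evalAt (g : Spec (.of F) ⟶ X) {V : X.Opens} (hV : IsAffineOpen V)
    (h : g (closedPoint F) ∈ V) {φ : Γ(X, V) →+* F}
    (hφ : Spec.map (CommRingCat.ofHom φ) ≫ hV.fromSpec = g) : φ = evalAt g h := by
  rw [← SpecMap_evalAt g hV h, cancel_mono, Spec.map_inj] at hφ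
  exact congr($(hφ).hom)

theorem SpecMap_fromSpec_mem {V : X.Opens} (hV : IsAffineOpen V) (φ : Γ(X, V) →+* F) :
    (Spec.map (CommRingCat.ofHom φ) ≫ hV.fromSpec) (closedPoint F) ∈ V := by
  have : hV.fromSpec (Spec.map (CommRingCat.ofHom φ) (closedPoint F)) ∈ Set.range hV.fromSpec :=
    ⟨_, rfl⟩
  rwa [hV.range_fromSpec] at this

theorem evalAt_SpecMap {F' : Type} [Field F'] (σ : F →+* F') (g : Spec (.of F) ⟶ X) {V : X.Opens}
    (hV : IsAffineOpen V) (h : g (closedPoint F) ∈ V)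
    (h' : (Spec.map (CommRingCat.ofHom σ) ≫ g) (closedPoint F') ∈ V) :
    evalAt (Spec.map (CommRingCat.ofHom σ) ≫ g) h' = σ.comp (evalAt g h) := by
  refine (eq_evalAt _ hV h' ?_).symm
  rw [CommRingCat.ofHom_comp, Spec.map_comp, Category.assoc, SpecMap_evalAt]

theorem evalAt_comp (g : Spec (.of F) ⟶ X) (f : X ⟶ Y) {U : Y.Opens} (hU : IsAffineOpen U)
    {V : X.Opens} (hV : IsAffineOpen V) (e : V ≤ f ⁻¹ᵁ U) (h : g (closedPoint F) ∈ V)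
    (h' : (g ≫ f) (closedPoint F) ∈ U) :
    evalAt (g ≫ f) h' = (evalAt g h).comp (f.appLE U V e).hom := by
  refine (eq_evalAt _ hU h' ?_).symm
  rw [CommRingCat.ofHom_comp, Spec.map_comp, Category.assoc, CommRingCat.ofHom_hom,
    IsAffineOpen.SpecMap_appLE_fromSpec _ _ hV, ← Category.assoc, SpecMap_evalAt]

theorem evalAt_eq_zero_iff (g : Spec (.of F) ⟶ X) {V : X.Opens} (h : g (closedPoint F) ∈ V)
    (s : Γ(X, V)) : evalAt g h s = 0 ↔ X.presheaf.germ V _ h s ∈ maximalIdeal _ := by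
  rw [IsLocalRing.mem_maximalIdeal, mem_nonunits_iff, 
    ← isUnit_map_iff (Scheme.stalkClosedPointTo g).hom, isUnit_iff_ne_zero, not_not]
  rfl

theorem evalAt_ne_zero_iff (g : Spec (.of F) ⟶ X) {V : X.Opens} (hV : IsAffineOpen V)
    (h : g (closedPoint F) ∈ V) (s : Γ(X, V)) :
    evalAt g h s ≠ 0 ↔ s ∈ (hV.primeIdealOf ⟨_, h⟩).asIdeal.primeCompl := by
  let := TopCat.Presheaf.algebra_section_stalk X.presheaf (⟨_, h⟩ : V)
  have := hV.isLocalization_stalk ⟨_, h⟩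
  rw [Ne, evalAt_eq_zero_iff, IsLocalRing.mem_maximalIdeal, mem_nonunits_iff, not_not]
  exact IsLocalization.AtPrime.isUnit_to_map_iff (X.presheaf.stalk (g (closedPoint F)))
    (hV.primeIdealOf ⟨_, h⟩).asIdeal s

theorem germ_stalkMap_eq (f : X ⟶ Y) {U : Y.Opens} {V : X.Opens} (e : V ≤ f ⁻¹ᵁ U) {x : X}
    (hx : x ∈ V) (hx' : f x ∈ U) : Y.presheaf.germ U (f x) hx' ≫ f.stalkMap x =
      f.appLE U V e ≫ X.presheaf.germ V x hx := by
  rw [Scheme.Hom.germ_stalkMap, Scheme.Hom.appLE, Category.assoc, X.presheaf.germ_res]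

/-- Stalks on affine opens are localizations, so the maximal ideal at `f x` is generated by sections
over `U`. An equation in the stalk at `x` becomes one in `Γ(X, V)` after multiplying by some `t`
that does not vanish at `x`. -/
theorem exists_mul_mem_of_map_stalkMap_eq (f : X ⟶ Y) {U : Y.Opens} (hU : IsAffineOpen U)
    {V : X.Opens} (hV : IsAffineOpen V) (e : V ≤ f ⁻¹ᵁ U) {x : X} (hx : x ∈ V)
    (h : (maximalIdeal (Y.presheaf.stalk (f x))).map (f.stalkMap x).hom =
      maximalIdeal (X.presheaf.stalk x))
    (s : Γ(X, V)) (hs : X.presheaf.germ V x hx s ∈ maximalIdeal (X.presheaf.stalk x)) :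
    ∃ t, X.presheaf.germ V x hx t ∉ maximalIdeal (X.presheaf.stalk x) ∧ t * s ∈
      ((maximalIdeal (X.presheaf.stalk x)).comap
        (f.appLE U V e ≫ X.presheaf.germ V x hx).hom).map (f.appLE U V e).hom := by
  let := TopCat.Presheaf.algebra_section_stalk X.presheaf (⟨x, hx⟩ : V)
  have := hV.isLocalization_stalk ⟨x, hx⟩
  have hx' : f x ∈ U := e hx
  let := TopCat.Presheaf.algebra_section_stalk Y.presheaf (⟨f x, hx'⟩ : U)
  have := hU.isLocalization_stalk ⟨f x, hx'⟩
  have h1 : ((maximalIdeal (Y.presheaf.stalk (f x))).comap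
      (Y.presheaf.germ U (f x) hx').hom).map (Y.presheaf.germ U (f x) hx').hom =
      maximalIdeal _ :=
    IsLocalization.map_under (hU.primeIdealOf ⟨f x, hx'⟩).asIdeal.primeCompl
      (Y.presheaf.stalk (f x)) _
  have h2 : (maximalIdeal (Y.presheaf.stalk (f x))).comap (Y.presheaf.germ U (f x) hx').hom =
      (maximalIdeal (X.presheaf.stalk x)).comap
        (f.appLE U V e ≫ X.presheaf.germ V x hx).hom := by
    rw [← germ_stalkMap_eq f e hx hx', CommRingCat.hom_comp, ← Ideal.comap_comap,
      IsLocalRing.maximalIdeal_comap (f.stalkMap x).hom]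
  rw [← h, ← h1, Ideal.map_map, ← CommRingCat.hom_comp, germ_stalkMap_eq f e hx hx', CommRingCat.hom_comp,
    ← Ideal.map_map, h2] at hs
  obtain ⟨t, ht, h4⟩ := (IsLocalization.algebraMap_mem_map_algebraMap_iff
    (hV.primeIdealOf ⟨_, hx⟩).asIdeal.primeCompl (X.presheaf.stalk x) _ _).1 hs
  refine ⟨t, ?_, h4⟩
  rw [IsLocalRing.mem_maximalIdeal, mem_nonunits_iff, not_not]
  exact (IsLocalization.AtPrime.isUnit_to_map_iff (X.presheaf.stalk x)
    (hV.primeIdealOf ⟨_, hx⟩).asIdeal t).2 ht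

end EvalAt

/-- Every element of the residue field is a quotient of values of sections over `V`, and a generated
field is closed under division. -/
theorem AlgPt.field_eq_adjoin_range {X : QSch} (P : AlgPt X) {V : X.left.Opens} 
    (hV : IsAffineOpen V) (h : P.left (closedPoint Qbar) ∈ V) :
    P.field = IntermediateField.adjoin ℚ (Set.range (evalAt (X := X.left) P.left h)) := by
  apply le_antisymm
  · rw [AlgPt.field, IntermediateField.adjoin_le_iff]
    rintro _ ⟨y, rfl⟩
    obtain ⟨z, rfl⟩ := X.left.residue_surjective (P.left (closedPoint Qbar)) y
    let := TopCat.Presheaf.algebra_section_stalk X.left.presheaf (⟨_, h⟩ : V)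
    have := hV.isLocalization_stalk ⟨_, h⟩
    obtain ⟨⟨a, t⟩, hz⟩ := IsLocalization.surj (S := X.left.presheaf.stalk _)
      (hV.primeIdealOf ⟨_, h⟩).asIdeal.primeCompl z
    have ht := (evalAt_ne_zero_iff (X := X.left) P.left hV h t).2 t.2
    have hz' : (Scheme.stalkClosedPointTo (X := X.left) P.left).hom z *
        evalAt (X := X.left) P.left h t = evalAt (X := X.left) P.left h a := by
      refine (map_mul (Scheme.stalkClosedPointTo (X := X.left) P.left).hom z _).symm.trans ?_
      exact congr((Scheme.stalkClosedPointTo (X := X.left) P.left).hom $hz)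
    have hz'' := (eq_div_iff ht).2 hz'
    change (Scheme.stalkClosedPointTo (X := X.left) P.left).hom z ∈ _
    rw [hz'']
    exact div_mem (IntermediateField.subset_adjoin _ _ ⟨_, rfl⟩)
      (IntermediateField.subset_adjoin _ _ ⟨_, rfl⟩)
  · refine IntermediateField.adjoin.mono _ _ _ ?_
    rintro _ ⟨s, rfl⟩
    exact ⟨X.left.residue _ (X.left.presheaf.germ V _ h s), rfl⟩

/-- At an unramified point, the vanishing ideal of the point is locally generated by the
vanishing ideal of its image. -/
theorem IsUnramifiedAt.exists_mul_mem {X Y : QSch} {f : X ⟶ Y} {F : Type} [Field F]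
    (g : Spec (.of F) ⟶ X.left) (hunr : IsUnramifiedAt f (g (closedPoint F)))
    {U : Y.left.Opens} (hU : IsAffineOpen U)
    {V : X.left.Opens} (hV : IsAffineOpen V) (e : V ≤ f.left ⁻¹ᵁ U) (h : g (closedPoint F) ∈ V)
    (s : Γ(X.left, V)) (hs : evalAt g h s = 0) :
    ∃ t, evalAt g h t ≠ 0 ∧ t * s ∈
      (RingHom.ker ((evalAt g h).comp (f.left.appLE U V e).hom)).map (f.left.appLE U V e).hom := by
  obtain ⟨t, ht, hts⟩ := exists_mul_mem_of_map_stalkMap_eq f.left hU hV e h hunr s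
    ((evalAt_eq_zero_iff g h s).1 hs)
  refine ⟨t, fun h0 => ht ((evalAt_eq_zero_iff g h t).1 h0), ?_⟩
  convert hts using 2
  ext r
  exact evalAt_eq_zero_iff g h _

/-- A ring admits at most one homomorphism from `ℚ`; compatibility with structure morphisms is
therefore automatic. -/
instance subsingleton_hom_base (T : Scheme.{0}) : Subsingleton (T ⟶ base) :=
  ⟨fun f g => ext_of_isAffine <| by
    rw [← cancel_epi (Scheme.ΓSpecIso (.of ℚ)).inv]
    exact CommRingCat.hom_ext (Subsingleton.elim (α := ℚ →+* Γ(T, ⊤)) _ _)⟩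

/-- Morphisms over `ℚ` are the same as morphisms of schemes. -/
def homMk {X Y : QSch} (g : X.left ⟶ Y.left) : X ⟶ Y := Over.homMk g (Subsingleton.elim _ _)

theorem hom_ext {X Y : QSch} {g g' : X ⟶ Y} (h : g.left = g'.left) : g = g' := Over.OverMorphism.ext h

/-! ### The dictionary between `fibre f β` and `PointsOver` -/

section Fibre

variable {X Y : QSch}

/-- The morphism of schemes underlying a rational point. -/
def RatPt.hom (β : RatPt Y) : Spec (.of ℚ) ⟶ Y.left := β.left

/-- The morphism of schemes underlying an algebraic point. -/
def AlgPt.hom (P : AlgPt X) : Spec (.of Qbar) ⟶ X.left := P.left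

/-- `Spec Qbar → Spec ℚ`. -/
def specAlgebraMap : Spec (.of Qbar) ⟶ Spec (.of ℚ) :=
  Spec.map (CommRingCat.ofHom (algebraMap ℚ Qbar))

/-- Evaluation of functions at a rational point. -/
def RatPt.eval (β : RatPt Y) {U : Y.left.Opens} (h : β.pt ∈ U) : Γ(Y.left, U) →+* ℚ :=
  evalAt β.hom h

/-- Evaluation of functions at an algebraic point. -/
def AlgPt.eval (P : AlgPt X) {V : X.left.Opens} (h : P.hom (closedPoint Qbar) ∈ V) :
    Γ(X.left, V) →+* Qbar :=
  evalAt P.hom h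

theorem RatPt.toAlgPt_hom (β : RatPt Y) : β.toAlgPt.hom = specAlgebraMap ≫ β.hom := by
  have : (Over.mkIdTerminal.from specQbar).left = specAlgebraMap :=
    (subsingleton_hom_base _).elim _ _
  exact congr($this ≫ β.hom)

variable {f : X ⟶ Y} {β : RatPt Y}

theorem AlgPt.mem_fibre_iff_hom (P : AlgPt X) :
    P ∈ fibre f β ↔ P.hom ≫ f.left = specAlgebraMap ≫ β.hom := by
  rw [← β.toAlgPt_hom]
  exact ⟨fun h => congr(($h).left), fun h => hom_ext h⟩

theorem apply_closedPoint_of_mem_fibre {P : AlgPt X} (hP : P ∈ fibre f β) :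
    f.left (P.hom (closedPoint Qbar)) = β.pt := by
  have h2 : (P.hom ≫ f.left) (closedPoint Qbar) = (specAlgebraMap ≫ β.hom) (closedPoint Qbar) :=
    congr($(P.mem_fibre_iff_hom.1 hP) (closedPoint Qbar))
  refine h2.trans ?_
  change β.hom (specAlgebraMap (closedPoint Qbar)) = _
  congr 1
  exact IsLocalRing.comap_closedPoint _

theorem AlgPt.ext_eval {P Q : AlgPt X} {V : X.left.Opens} (hV : IsAffineOpen V)
    (hP : P.hom (closedPoint Qbar) ∈ V) (hQ : Q.hom (closedPoint Qbar) ∈ V)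
    (h : P.eval hP = Q.eval hQ) : P = Q := by
  apply hom_ext
  change P.hom = Q.hom
  rw [← SpecMap_evalAt P.hom hV hP, ← SpecMap_evalAt Q.hom hV hQ]
  exact congr(Spec.map (CommRingCat.ofHom $h) ≫ _)

theorem AlgPt.eval_conj (P : AlgPt X) (σ : Qbar ≃ₐ[ℚ] Qbar) {V : X.left.Opens}
    (hV : IsAffineOpen V) (h : P.hom (closedPoint Qbar) ∈ V)
    (h' : (P.conj σ).hom (closedPoint Qbar) ∈ V) :
    (P.conj σ).eval h' = (σ : Qbar →+* Qbar).comp (P.eval h) :=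
  evalAt_SpecMap (σ : Qbar →+* Qbar) P.hom hV h h'

theorem AlgPt.conj_mem_fibre {P : AlgPt X} (hP : P ∈ fibre f β) (σ : Qbar ≃ₐ[ℚ] Qbar) :
    P.conj σ ∈ fibre f β := by
  rw [AlgPt.mem_fibre_iff_hom] at hP ⊢
  change (Spec.map (CommRingCat.ofHom (σ : Qbar →+* Qbar)) ≫ P.hom) ≫ f.left = _
  rw [Category.assoc, hP, ← Category.assoc]
  exact congr($((subsingleton_hom_base _).elim _ _) ≫ β.hom)

section Affine

variable {U : Y.left.Opens} (hU : IsAffineOpen U) {V : X.left.Opens} (hV : IsAffineOpen V)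
  (e : V ≤ f.left ⁻¹ᵁ U) (hβ : β.pt ∈ U)

include hU hV e in
theorem AlgPt.mem_fibre_iff (P : AlgPt X) (h : P.hom (closedPoint Qbar) ∈ V) :
    P ∈ fibre f β ↔ (P.eval h).comp (f.left.appLE U V e).hom =
      (algebraMap ℚ Qbar).comp (β.eval hβ) := by
  have hU1 : (P.hom ≫ f.left) (closedPoint Qbar) ∈ U := e h
  have hU2 : (specAlgebraMap ≫ β.hom) (closedPoint Qbar) ∈ U := by
    have : specAlgebraMap (closedPoint Qbar) = closedPoint ℚ :=
      IsLocalRing.comap_closedPoint _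
    change β.hom (specAlgebraMap (closedPoint Qbar)) ∈ U
    rw [this]
    exact hβ
  have h1 := evalAt_comp P.hom f.left hU hV e h hU1
  have h2 : evalAt (specAlgebraMap ≫ β.hom) hU2 = _ :=
    evalAt_SpecMap (algebraMap ℚ Qbar) β.hom hU hβ hU2
  rw [AlgPt.eval, RatPt.eval, ← h1, AlgPt.mem_fibre_iff_hom]
  refine Iff.trans ?_ (Eq.congr_right h2)
  constructor
  · intro h
    congr 1
  · intro h
    rw [← SpecMap_evalAt _ hU hU1, h, SpecMap_evalAt _ hU hU2]

include hU hV e in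
theorem AlgPt.exists_mem_fibre {φ : Γ(X.left, V) →+* Qbar}
    (hφ : φ.comp (f.left.appLE U V e).hom = (algebraMap ℚ Qbar).comp (β.eval hβ)) :
    ∃ (P : AlgPt X) (h : P.hom (closedPoint Qbar) ∈ V), P ∈ fibre f β ∧ P.eval h = φ := by
  let P : AlgPt X := homMk (Spec.map (CommRingCat.ofHom φ) ≫ hV.fromSpec)
  have h : P.hom (closedPoint Qbar) ∈ V := SpecMap_fromSpec_mem hV φ
  have h1 : P.eval h = φ := (eq_evalAt _ hV h rfl).symm
  refine ⟨P, h, ?_, h1⟩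
  rw [AlgPt.mem_fibre_iff hU hV e hβ P h, h1, hφ]

include hU hV e in
theorem RatPt.exists_comp_eq {φ : Γ(X.left, V) →+* ℚ}
    (hφ : φ.comp (f.left.appLE U V e).hom = β.eval hβ) :
    ∃ w : RatPt X, w ≫ f = β := by
  let w : RatPt X := homMk (Spec.map (CommRingCat.ofHom φ) ≫ hV.fromSpec)
  refine ⟨w, hom_ext ?_⟩
  change (Spec.map (CommRingCat.ofHom φ) ≫ hV.fromSpec) ≫ f.left = β.hom
  rw [← SpecMap_evalAt β.hom hU hβ,
    Category.assoc, ← IsAffineOpen.SpecMap_appLE_fromSpec f.left hU hV e, ← Category.assoc,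
    ← Spec.map_comp]
  exact congr(Spec.map (CommRingCat.ofHom $hφ) ≫ _)

/-- The structure of a `ℚ`-algebra on the functions on an open subset. -/
def sectionsAlgebraMap (X : QSch) (V : X.left.Opens) : ℚ →+* Γ(X.left, V) :=
  ((Scheme.ΓSpecIso (.of ℚ)).inv ≫ X.hom.appLE ⊤ V le_top).hom

/-- Constants are sections, and the only ring endomorphism of `ℚ` is the identity. -/
theorem RatPt.eval_surjective : Function.Surjective (β.eval hβ) := fun q =>
  ⟨sectionsAlgebraMap Y U q,
    congr($(Subsingleton.elim ((β.eval hβ).comp (sectionsAlgebraMap Y U)) (RingHom.id ℚ)) q)⟩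

end Affine

end Fibre

/-! ### Computing the degree on affine charts -/

theorem finrank_eq_of_isFractionRing {R B S T K L : Type*} [CommRing R] [CommRing B] [CommRing S]
    [CommRing T] [Field K] [Field L] [Algebra R S] [IsFractionRing R S] [Algebra B T]
    [IsFractionRing B T] [Algebra R K] [IsFractionRing R K] [Algebra B L] [IsFractionRing B L]
    [Algebra S T] [Algebra K L] (g : R → B)
    (h₁ : ∀ r, algebraMap S T (algebraMap R S r) = algebraMap B T (g r))
    (h₂ : ∀ r, algebraMap K L (algebraMap R K r) = algebraMap B L (g r)) :
    Module.finrank S T = Module.finrank K L := by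
  let i : S ≃ₐ[R] K := IsLocalization.algEquiv (nonZeroDivisors R) S K
  let j : T ≃ₐ[B] L := IsLocalization.algEquiv (nonZeroDivisors B) T L
  refine Algebra.finrank_eq_of_equiv_equiv i.toRingEquiv j.toRingEquiv ?_
  refine IsLocalization.ringHom_ext (nonZeroDivisors R) (RingHom.ext fun r => ?_)
  change algebraMap K L (i (algebraMap R S r)) = j (algebraMap S T (algebraMap R S r))
  rw [h₁, i.commutes, j.commutes, h₂]

/-- The generic point of `X` is the zero ideal of `Γ(X, V)`. By injectivity it contracts to the zero
ideal of `Γ(Y, U)`, so the stalks in the definition of `degree` are the two fraction fields. -/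
theorem degree_eq_finrank {X Y : QSch} (hX : IsVariety X) (f : X ⟶ Y) {U : Y.left.Opens}
    (hU : IsAffineOpen U) {V : X.left.Opens} (hV : IsAffineOpen V) (e : V ≤ f.left ⁻¹ᵁ U)
    (hne : (V : Set X.left).Nonempty) [IsDomain Γ(Y.left, U)]
    (hinj : Function.Injective (f.left.appLE U V e))
    {K L : Type*} [Field K] [Field L] [Algebra Γ(Y.left, U) K] [IsFractionRing Γ(Y.left, U) K]
    [Algebra Γ(X.left, V) L] [IsFractionRing Γ(X.left, V) L] [Algebra K L]
    (hKL : ∀ r, algebraMap K L (algebraMap Γ(Y.left, U) K r) =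
      algebraMap Γ(X.left, V) L (f.left.appLE U V e r)) :
    degree hX f = Module.finrank K L := by
  have := hX.isIntegral
  have hx : genericPoint X.left ∈ V :=
    ((genericPoint_spec X.left).mem_open_set_iff V.isOpen).2 (by simpa using hne)
  have hx' : f.left (genericPoint X.left) ∈ U := e hx
  have : Nonempty V := ⟨⟨_, hx⟩⟩
  let := TopCat.Presheaf.algebra_section_stalk Y.left.presheaf
    (⟨f.left (genericPoint X.left), hx'⟩ : U)
  have hp := IsAffineOpen.comap_primeIdealOf_appLE U hU V hV e hx
  have h0 : hV.primeIdealOf ⟨genericPoint X.left, hx⟩ = genericPoint (Spec Γ(X.left, V)) :=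
    IsAffineOpen.primeIdealOf_genericPoint hV
  rw [h0, genericPoint_eq_bot_of_affine] at hp
  have hp' : (hU.primeIdealOf ⟨f.left (genericPoint X.left), hx'⟩).asIdeal = ⊥ := by
    rw [← hp]
    exact (RingHom.injective_iff_ker_eq_bot (f.left.appLE U V e).hom).1 hinj
  have : IsFractionRing Γ(Y.left, U) (Y.left.presheaf.stalk (f.left (genericPoint X.left))) := by
    have h1 := hU.isLocalization_stalk ⟨f.left (genericPoint X.left), hx'⟩
    unfold IsFractionRing
    have h2 : nonZeroDivisors Γ(Y.left, U) =
        (hU.primeIdealOf ⟨f.left (genericPoint X.left), hx'⟩).asIdeal.primeCompl := by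
      ext r
      rw [mem_nonZeroDivisors_iff_ne_zero, Ideal.mem_primeCompl_iff, hp', Ideal.mem_bot]
    rw [h2]
    exact h1
  have := functionField_isFractionRing_of_isAffineOpen X.left V hV
  let := (f.left.stalkMap (genericPoint X.left)).hom.toAlgebra
  refine finrank_eq_of_isFractionRing (f.left.appLE U V e) (fun r => ?_) hKL
  exact congr($(germ_stalkMap_eq f.left e hx hx') r)

theorem appLE_SpecMap_fromSpec {Y : Scheme.{0}} {U : Y.Opens} (hU : IsAffineOpen U)
    {A : CommRingCat.{0}} (φ : Γ(Y, U) ⟶ A) (e : ⊤ ≤ (Spec.map φ ≫ hU.fromSpec) ⁻¹ᵁ U) :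
    (Spec.map φ ≫ hU.fromSpec).appLE U ⊤ e = φ ≫ (Scheme.ΓSpecIso A).inv := by
  have h := IsAffineOpen.SpecMap_appLE_fromSpec (Spec.map φ ≫ hU.fromSpec) hU (isAffineOpen_top _) e
  rw [← Category.assoc, cancel_mono, IsAffineOpen.fromSpec_top, Scheme.isoSpec_Spec_inv,
    ← Spec.map_comp, Spec.map_inj] at h
  exact h

/-! ### Finite algebras over a chart as covering varieties -/

section FiniteCover

variable {Y : QSch} {U : Y.left.Opens} (hU : IsAffineOpen U) (D : Type) [CommRing D]
  [Algebra Γ(Y.left, U) D]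

/-- The spectrum of an algebra over the functions on an affine open subset `U` of `Y`. -/
def specOver : QSch :=
  Over.mk ((Spec.map (CommRingCat.ofHom (algebraMap Γ(Y.left, U) D)) ≫ hU.fromSpec) ≫ Y.hom)

/-- The morphism `Spec D ⟶ Y`. -/
def specOver.π : specOver hU D ⟶ Y :=
  Over.homMk (Spec.map (CommRingCat.ofHom (algebraMap Γ(Y.left, U) D)) ≫ hU.fromSpec) rfl

theorem specOver.isVariety [IsDomain D] [Module.Finite Γ(Y.left, U) D]
    (hY : LocallyOfFiniteType Y.hom) : IsVariety (specOver hU D) := by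
  have hfin : IsFinite (Spec.map (CommRingCat.ofHom (algebraMap Γ(Y.left, U) D))) :=
    (IsFinite.SpecMap_iff _).2 (RingHom.finite_algebraMap.2 inferInstance)
  let g : Spec (.of D) ⟶ Spec (.of ℚ) := (specOver hU D).hom
  have hs : IsSeparated g := inferInstance
  have hq : QuasiCompact g := inferInstance
  exact ⟨inferInstanceAs (IsIntegral (Spec (.of D))), 
    hs,
    inferInstanceAs (LocallyOfFiniteType ((Spec.map (CommRingCat.ofHom
      (algebraMap Γ(Y.left, U) D)) ≫ hU.fromSpec) ≫ Y.hom)),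
    hq⟩

theorem specOver.isDominant_π [IrreducibleSpace Y.left] (hne : (U : Set Y.left).Nonempty)
    (hinj : Function.Injective (algebraMap Γ(Y.left, U) D)) :
    IsDominant (specOver.π hU D).left := by
  have h1 : IsDominant (Spec.map (CommRingCat.ofHom (algebraMap Γ(Y.left, U) D))) := ⟨by
    refine (PrimeSpectrum.denseRange_comap_iff_ker_le_nilRadical (algebraMap Γ(Y.left, U) D)).2 ?_
    rw [(RingHom.injective_iff_ker_eq_bot _).1 hinj]
    exact bot_le⟩
  have h2 : IsDominant hU.fromSpec := ⟨by
    rw [DenseRange, hU.range_fromSpec]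
    exact U.isOpen.dense hne⟩
  exact inferInstanceAs (IsDominant (Spec.map (CommRingCat.ofHom
      (algebraMap Γ(Y.left, U) D)) ≫ hU.fromSpec))

theorem specOver.degree_π (hW : IsVariety (specOver hU D)) [IsDomain D] [IsDomain Γ(Y.left, U)]
    (hinj : Function.Injective (algebraMap Γ(Y.left, U) D))
    {K L : Type*} [Field K] [Field L] [Algebra Γ(Y.left, U) K] [IsFractionRing Γ(Y.left, U) K]
    [Algebra D L] [IsFractionRing D L] [Algebra K L] [Algebra Γ(Y.left, U) L]
    [IsScalarTower Γ(Y.left, U) K L] [IsScalarTower Γ(Y.left, U) D L] :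
    degree hW (specOver.π hU D) = Module.finrank K L := by
  have e : (⊤ : (specOver hU D).left.Opens) ≤ (specOver.π hU D).left ⁻¹ᵁ U := fun x _ => by
    change hU.fromSpec (Spec.map (CommRingCat.ofHom (algebraMap Γ(Y.left, U) D)) x) ∈ (U : Set Y.left)
    rw [← hU.range_fromSpec]
    exact ⟨_, rfl⟩
  have : IsAffine (specOver hU D).left := inferInstanceAs (IsAffine (Spec (.of D)))
  let c : Γ((specOver hU D).left, ⊤) ≃+* D := (Scheme.ΓSpecIso (.of D)).commRingCatIsoToRingEquiv
  have happ : ∀ r, c ((specOver.π hU D).left.appLE U ⊤ e r) = algebraMap Γ(Y.left, U) D r := fun r => by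
    rw [← c.eq_symm_apply]
    exact congr($(appLE_SpecMap_fromSpec hU (CommRingCat.ofHom (algebraMap Γ(Y.left, U) D)) e) r)
  let : Algebra Γ((specOver hU D).left, ⊤) L := ((algebraMap D L).comp (c : _ →+* D)).toAlgebra
  have hc : ∀ s, algebraMap Γ((specOver hU D).left, ⊤) L s = algebraMap D L (c s) := fun s => rfl
  have : FaithfulSMul Γ((specOver hU D).left, ⊤) L :=
    (faithfulSMul_iff_algebraMap_injective _ _).2 ((IsFractionRing.injective D L).comp c.injective)
  have : IsFractionRing Γ((specOver hU D).left, ⊤) L := IsFractionRing.of_field _ _ fun z => by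
    obtain ⟨x, y, -, h⟩ := IsFractionRing.div_surjective (A := D) z
    exact ⟨c.symm x, c.symm y, by rw [hc, hc, c.apply_symm_apply, c.apply_symm_apply, h]⟩
  refine degree_eq_finrank hW (specOver.π hU D) hU (isAffineOpen_top _) e ?_ ?_ fun r => ?_
  · exact ⟨(⊥ : PrimeSpectrum D), trivial⟩
  · refine .of_comp (f := c) ?_
    convert hinj
    exact funext happ
  · rw [hc, happ, ← IsScalarTower.algebraMap_apply, ← IsScalarTower.algebraMap_apply]

end FiniteCover

/-! ### Kernels of points, and thin sets from finite algebras -/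

theorem PointsOver.exists_ker_eq {R B : Type*} [CommRing R] [CommRing B] [Algebra R B]
    [Algebra.IsIntegral R B] {b : R →+* ℚ} (hb : Function.Surjective b) (n : Ideal B)
    [n.IsMaximal] (hn : (RingHom.ker b).map (algebraMap R B) ≤ n) :
    ∃ φ : B →+* Qbar, φ ∈ PointsOver b ∧ RingHom.ker φ = n := by
  have hm : (RingHom.ker b).IsMaximal := RingHom.ker_isMaximal_of_surjective b hb
  have hcomap : RingHom.ker b = n.comap (algebraMap R B) :=
    hm.eq_of_le (Ideal.IsPrime.comap _).ne_top (Ideal.map_le_iff_le_comap.1 hn)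
  have : n.LiesOver (RingHom.ker b) := ⟨hcomap⟩
  let b' : (R ⧸ RingHom.ker b) →+* ℚ := RingHom.kerLift b
  have hinj : Function.Injective (algebraMap (R ⧸ RingHom.ker b) (B ⧸ n)) :=
    FaithfulSMul.algebraMap_injective _ _
  obtain ⟨ψ, hψ⟩ := exists_comp_algebraMap_eq hinj ((algebraMap ℚ Qbar).comp b')
  let := Ideal.Quotient.field n
  refine ⟨ψ.comp (Ideal.Quotient.mk n), RingHom.ext fun r => ?_, ?_⟩
  · exact congr($hψ (Ideal.Quotient.mk _ r))
  · rw [RingHom.ker_comp_of_injective _ ψ.injective, Ideal.mk_ker]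

/-- For `s ∈ ker φ` consider the colon ideal `(J : s)` of `J = (ker b)B`. A maximal ideal containing
it contains `J`, hence is the kernel of a point over `b`, hence is `ker φ`. But `hunr` puts an
element outside `ker φ` into `(J : s)`, so `(J : s)` is the unit ideal and `s ∈ J`. -/
theorem PointsOver.ker_eq_map {R B : Type*} [CommRing R] [CommRing B] [Algebra R B]
    [Algebra.IsIntegral R B] {b : R →+* ℚ} (hb : Function.Surjective b) {φ : B →+* Qbar}
    (hφ : φ ∈ PointsOver b) (horb : ∀ φ' ∈ PointsOver b, RingHom.ker φ' = RingHom.ker φ)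
    (hunr : ∀ s, φ s = 0 → ∃ t, φ t ≠ 0 ∧ t * s ∈ (RingHom.ker b).map (algebraMap R B)) :
    RingHom.ker φ = (RingHom.ker b).map (algebraMap R B) := by
  apply le_antisymm
  · intro s hs
    set J := (RingHom.ker b).map (algebraMap R B)
    let I : Ideal B := Submodule.comap (LinearMap.toSpanSingleton B B s) J
    have hI : ∀ t, t ∈ I ↔ t * s ∈ J := fun t => Iff.rfl
    suffices h : I = ⊤ by
      have := (hI 1).1 (h ▸ Submodule.mem_top)
      rwa [one_mul] at this
    by_contra h
    obtain ⟨n, hn, hIn⟩ := Ideal.exists_le_maximal I h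
    obtain ⟨φ', hφ', hker⟩ := PointsOver.exists_ker_eq hb n
      (le_trans (fun t ht => (hI t).2 (J.mul_mem_right _ ht)) hIn)
    obtain ⟨t, ht, hts⟩ := hunr s hs
    have : t ∈ RingHom.ker φ' := by rw [hker]; exact hIn ((hI t).2 hts)
    rw [horb φ' hφ'] at this
    exact ht this
  · rw [Ideal.map_le_iff_le_comap]
    intro r hr
    rw [Ideal.mem_comap, RingHom.mem_ker]
    refine (congr($hφ r)).trans ?_
    rw [RingHom.comp_apply, RingHom.mem_ker.1 hr, map_zero]

theorem IsThinC2.of_specOver {Y : QSch} [IrreducibleSpace Y.left] (hY : LocallyOfFiniteType Y.hom)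
    {U : Y.left.Opens} (hU : IsAffineOpen U) (hne : (U : Set Y.left).Nonempty)
    [IsDomain Γ(Y.left, U)] (D : Type) [CommRing D] [IsDomain D] [Algebra Γ(Y.left, U) D]
    [Module.Finite Γ(Y.left, U) D] (hinj : Function.Injective (algebraMap Γ(Y.left, U) D))
    {K L : Type*} [Field K] [Field L] [Algebra Γ(Y.left, U) K] [IsFractionRing Γ(Y.left, U) K]
    [Algebra D L] [IsFractionRing D L] [Algebra K L] [Algebra Γ(Y.left, U) L]
    [IsScalarTower Γ(Y.left, U) K L] [IsScalarTower Γ(Y.left, U) D L]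
    (h2 : 2 ≤ Module.finrank K L) :
    IsThinC2 {β : RatPt Y | ∃ (h : β.pt ∈ U) (c : D →+* ℚ),
      c.comp (algebraMap Γ(Y.left, U) D) = β.eval h} := by
  have hW := specOver.isVariety hU D hY
  refine ⟨specOver hU D, hW, specOver.π hU D, specOver.isDominant_π hU D hne hinj, ?_, ?_⟩
  · rwa [specOver.degree_π hU D hW hinj (K := K) (L := L)]
  · rintro β ⟨h, c, hc⟩
    let g : Spec (.of ℚ) ⟶ (specOver hU D).left := Spec.map (CommRingCat.ofHom c)
    refine ⟨homMk g, hom_ext ?_⟩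
    change Spec.map (CommRingCat.ofHom c) ≫
      Spec.map (CommRingCat.ofHom (algebraMap Γ(Y.left, U) D)) ≫ hU.fromSpec = β.hom
    rw [← Category.assoc, ← Spec.map_comp, ← CommRingCat.ofHom_comp, hc]
    exact SpecMap_evalAt β.hom hU h

/-- A homomorphism to `Qbar` with rational values is defined over `ℚ`. -/
theorem exists_comp_algebraMap_eq_of_mem_bot {B : Type*} [CommRing B] (φ : B →+* Qbar)
    (h : ∀ x, φ x ∈ (⊥ : IntermediateField ℚ Qbar)) :
    ∃ c : B →+* ℚ, (algebraMap ℚ Qbar).comp c = φ := by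
  refine ⟨(IntermediateField.botEquiv ℚ Qbar : (⊥ : IntermediateField ℚ Qbar) →+* ℚ).comp
    (φ.codRestrict (⊥ : IntermediateField ℚ Qbar) h), RingHom.ext fun x => ?_⟩
  have h2 : ∀ y : (⊥ : IntermediateField ℚ Qbar),
      algebraMap ℚ Qbar (IntermediateField.botEquiv ℚ Qbar y) = y := fun y => by
    obtain ⟨q, rfl⟩ := (IntermediateField.botEquiv ℚ Qbar).symm.surjective y
    simp
  exact h2 _

theorem exists_isGalois_algHom (K L : Type) [Field K] [Field L] [Algebra K L]
    [FiniteDimensional K L] [CharZero K] :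
    ∃ (N : Type) (_ : Field N) (_ : Algebra K N) (_ : FiniteDimensional K N) (_ : IsGalois K N),
      Nonempty (L →ₐ[K] N) :=
  ⟨IntermediateField.normalClosure K L (AlgebraicClosure L), inferInstance, inferInstance, inferInstance,
    ⟨⟩, ⟨IsScalarTower.toAlgHom K L _⟩⟩

/-! ### The proposition for a finite dominant morphism -/

section Main

variable {X Y : QSch}

/-- By the primitive element theorem `N/K` has finitely many intermediate fields. Each `M ≠ K`
contributes the points that lift to the integral closure of `R` in `M`, a set of type `C₂`; the
points outside `U` are of type `C₁`. -/
theorem exists_isThin_isGeneric [IrreducibleSpace Y.left] (hY : LocallyOfFiniteType Y.hom)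
    {U : Y.left.Opens} (hU : IsAffineOpen U) (hne : (U : Set Y.left).Nonempty)
    [IsDomain Γ(Y.left, U)] [IsNoetherianRing Γ(Y.left, U)] [IsIntegrallyClosed Γ(Y.left, U)]
    {K N : Type} [Field K] [Field N] [Algebra Γ(Y.left, U) K] [IsFractionRing Γ(Y.left, U) K]
    [Algebra K N] [Algebra Γ(Y.left, U) N] [IsScalarTower Γ(Y.left, U) K N]
    [FiniteDimensional K N] [IsGalois K N] :
    ∃ S : Set (RatPt Y), IsThin S ∧
      ∀ β ∉ S, ∃ h : β.pt ∈ U, IsGeneric Γ(Y.left, U) K N (β.eval h) := by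
  let R := Γ(Y.left, U)
  let S₀ : Set (RatPt Y) := {β | β.pt ∉ U}
  let S₁ : {M : IntermediateField K N // M ≠ ⊥} → Set (RatPt Y) := fun M =>
    {β | ∃ (h : β.pt ∈ U) (c : integralClosure R M.1 →+* ℚ),
      c.comp (algebraMap R (integralClosure R M.1)) = β.eval h}
  have : Finite (IntermediateField K N) :=
    (Field.exists_primitive_element_iff_finite_intermediateField K N).1
      ⟨inferInstance, Field.exists_primitive_element K N⟩
  refine ⟨⋃₀ (insert S₀ (Set.range S₁)), ⟨_, (Set.finite_range _).insert _, ?_, subset_rfl⟩,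
    fun β hβ => ?_⟩
  · rintro _ (rfl | ⟨M, rfl⟩)
    · exact .inl ⟨(U : Set Y.left)ᶜ, U.isOpen.isClosed_compl,
        fun h => hne.ne_empty (Set.compl_univ_iff.1 h), fun a ha => ha⟩
    · right
      have h1 : IsFractionRing (integralClosure R M.1) M.1 :=
        IsIntegralClosure.isFractionRing_of_finite_extension R K M.1 _
      have h2 : Module.Finite R (integralClosure R M.1) := IsIntegralClosure.finite R K M.1 _
      refine IsThinC2.of_specOver hY hU hne (integralClosure R M.1) ?_ (K := K) (L := M.1) ?_
      · refine .of_comp (f := algebraMap (integralClosure R M.1) M.1) ?_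
        rw [← RingHom.coe_comp, ← IsScalarTower.algebraMap_eq, IsScalarTower.algebraMap_eq R K M.1]
        exact (algebraMap K M.1).injective.comp (IsFractionRing.injective R K)
      · have h3 : 0 < Module.finrank K M.1 := Module.finrank_pos
        have h4 : Module.finrank K M.1 ≠ 1 := fun h =>
          M.2 (IntermediateField.finrank_eq_one_iff.1 h)
        omega
  · have hβU : β.pt ∈ U := by
      by_contra h
      exact hβ ⟨S₀, .inl rfl, h⟩
    exact ⟨hβU, fun M hM c hc => hβ ⟨_, .inr ⟨⟨M, hM⟩, rfl⟩, hβU, c, hc⟩⟩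

theorem IsThin.union {S T : Set (RatPt Y)} (hS : IsThin S) (hT : IsThin T) : IsThin (S ∪ T) := by
  obtain ⟨A, hA, hA', hSA⟩ := hS
  obtain ⟨B, hB, hB', hTB⟩ := hT
  refine ⟨A ∪ B, hA.union hB, fun C hC => hC.elim (hA' C) (hB' C), ?_⟩
  rw [Set.sUnion_union]
  exact Set.union_subset_union hSA hTB

theorem isThin_range (hX : IsVariety X) (f : X ⟶ Y) [IsDominant f.left] (h : 2 ≤ degree hX f) :
    IsThin {β : RatPt Y | ∃ w : RatPt X, w ≫ f = β} :=
  ⟨{{β : RatPt Y | ∃ w : RatPt X, w ≫ f = β}}, Set.finite_singleton _,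
    fun _ hB => .inr ⟨X, hX, f, inferInstance, h, fun a ha => by rw [hB] at ha; exact ha⟩,
    by rw [Set.sUnion_singleton]⟩

theorem isThin_empty : IsThin (∅ : Set (RatPt Y)) :=
  ⟨∅, Set.finite_empty, fun _ h => h.elim, by simp⟩

theorem intermediateField_le_fieldRange {K L N : Type*} [Field K] [Field L] [Field N] [Algebra K L]
    [Algebra K N] (j : L →ₐ[K] N) (h : ∀ M : IntermediateField K L, M = ⊥ ∨ M = ⊤)
    (M : IntermediateField K N) (hM : M ≤ j.fieldRange) : M = ⊥ ∨ M = j.fieldRange := by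
  have h1 : (M.comap j).map j = M := by
    apply le_antisymm
    · rintro _ ⟨x, hx, rfl⟩
      exact hx
    · intro x hx
      obtain ⟨y, rfl⟩ := hM hx
      exact ⟨y, hx, rfl⟩
  rcases h (M.comap j) with h | h
  · left
    rw [← h1, h, IntermediateField.map_bot]
  · right
    rw [← h1, h, AlgHom.fieldRange_eq_map]

variable (hX : IsVariety X) [IrreducibleSpace Y.left]
  (hY : LocallyOfFiniteType Y.hom) (f : X ⟶ Y) [IsFinite f.left] [IsDominant f.left]
  {U : Y.left.Opens} (hU : IsAffineOpen U) [IsDomain Γ(Y.left, U)]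
  [IsPrincipalIdealRing Γ(Y.left, U)]
  {α : RatPt Y} (hα : α.pt ∈ U)

include hU hY hα in
theorem finrank_field_and_exists_isThin (hinj : Function.Injective (f.left.app U))
    (hbr : ¬ IsBranchValue f α)
    (hfib : IsGaloisOrbit (fibre f α)) (P : AlgPt X) (hP : P ∈ fibre f α)
    (hprim : IsPrimitiveField P.field) :
    Module.finrank ℚ P.field = degree hX f ∧
    ∃ S : Set (RatPt Y), IsThin S ∧
      ∀ β : RatPt Y, β ∉ S →
        IsGaloisOrbit (fibre f β) ∧
        ∀ Q ∈ fibre f β, IsPrimitiveField Q.field ∧ Module.finrank ℚ Q.field = degree hX f := by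
  have := hX.isIntegral
  let V := f.left ⁻¹ᵁ U
  have hV : IsAffineOpen V := hU.preimage f.left
  have hVfib : ∀ {β : RatPt Y} (_ : β.pt ∈ U) {Q : AlgPt X}, Q ∈ fibre f β →
      Q.hom (closedPoint Qbar) ∈ V := fun hβ Q hQ => by
    change f.left (Q.hom (closedPoint Qbar)) ∈ U
    rwa [apply_closedPoint_of_mem_fibre hQ]
  have hPV := hVfib hα hP
  let R := Γ(Y.left, U)
  let B := Γ(X.left, V)
  let i : R →+* B := (f.left.appLE U V le_rfl).hom
  have hi : Function.Injective i := by
    change Function.Injective (f.left.appLE U V le_rfl)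
    rwa [Scheme.Hom.appLE_eq_app]
  have : Nonempty V := ⟨⟨_, hPV⟩⟩
  have : IsDomain B := inferInstance
  let : Algebra R B := i.toAlgebra
  have : FaithfulSMul R B := (faithfulSMul_iff_algebraMap_injective R B).2 hi
  have hfin : Module.Finite R B := by
    change i.Finite
    change (f.left.appLE U V le_rfl).hom.Finite
    rw [Scheme.Hom.appLE_eq_app]
    exact f.left.finite_app U hU
  let : Algebra ℚ R := (sectionsAlgebraMap Y U).toAlgebra
  let : Algebra ℚ B := (sectionsAlgebraMap X V).toAlgebra
  let K := FractionRing R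
  let L := FractionRing B
  let : Algebra K L := FractionRing.liftAlgebra R L
  have : IsScalarTower R K L := FractionRing.isScalarTower_liftAlgebra _ _
  have hKL : FiniteDimensional K L := .of_isLocalization R B (nonZeroDivisors R)
  have hK0 : CharZero K :=
    charZero_of_injective_ringHom ((algebraMap R K).comp (algebraMap ℚ R)).injective
  have hdeg : degree hX f = Module.finrank K L :=
    degree_eq_finrank hX f hU hV le_rfl ⟨_, hPV⟩ hi fun r => by
      rw [← IsScalarTower.algebraMap_apply R K L, IsScalarTower.algebraMap_apply R B L]
      rfl
  have hfield : ∀ {β : RatPt Y} (hβ : β.pt ∈ U) {Q : AlgPt X} (hQ : Q ∈ fibre f β),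
      Q.eval (hVfib hβ hQ) ∈ PointsOver (β.eval hβ) ∧
      Q.field = IntermediateField.adjoin ℚ (Set.range (Q.eval (hVfib hβ hQ))) :=
    fun hβ Q hQ => ⟨(Q.mem_fibre_iff hU hV le_rfl hβ _).1 hQ, Q.field_eq_adjoin_range hV _⟩
  have hb := α.eval_surjective hα
  obtain ⟨hPα, hPf⟩ := hfield hα hP
  have hker : RingHom.ker (P.eval hPV) = (RingHom.ker (α.eval hα)).map (algebraMap R B) := by
    refine PointsOver.ker_eq_map hb hPα (fun φ' hφ' => ?_) (fun s hs => ?_)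
    -- Conjugate points have evaluations with the same kernel, so a fibre that is one orbit has only
    -- one kernel.
    · obtain ⟨Q, hQV, hQ, rfl⟩ := AlgPt.exists_mem_fibre hU hV le_rfl hα hφ'
      obtain ⟨P₀, h₀⟩ := hfib
      have hP₀ : P₀ ∈ fibre f α := by
        rw [h₀]
        refine ⟨1, hom_ext ?_⟩
        exact congr($(Spec.map_id (.of Qbar)) ≫ P₀.hom).trans (Category.id_comp P₀.hom)
      have h1 : ∀ Q ∈ fibre f α, ∀ h, RingHom.ker (Q.eval h) = RingHom.ker (P₀.eval (hVfib hα hP₀)) := by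
        intro Q hQ h
        obtain ⟨σ, rfl⟩ := h₀ ▸ hQ
        rw [P₀.eval_conj σ hV (hVfib hα hP₀)]
        exact RingHom.ker_comp_of_injective _ σ.injective
      rw [h1 Q hQ, h1 P hP]
    · have hunr : IsUnramifiedAt f (P.hom (closedPoint Qbar)) := by
        by_contra h
        exact hbr ⟨_, apply_closedPoint_of_mem_fibre hP, h⟩
      obtain ⟨t, ht, hts⟩ := hunr.exists_mul_mem P.hom hU hV le_rfl hPV s hs
      refine ⟨t, ht, ?_⟩
      have h2 : (evalAt P.hom hPV).comp (f.left.appLE U V le_rfl).hom =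
        (algebraMap ℚ Qbar).comp (α.eval hα) := hPα
      rw [h2, RingHom.ker_comp_of_injective _ (algebraMap ℚ Qbar).injective] at hts
      exact hts
  rw [hPf] at hprim
  refine ⟨?_, ?_⟩
  · rw [hPf, hdeg]
    exact finrank_adjoin_range hb hPα hker
  have hbt : ∀ M : IntermediateField K L, M = ⊥ ∨ M = ⊤ :=
    eq_bot_or_eq_top_of_isPrimitiveField hb hPα hker hprim
  obtain ⟨N, _, _, _, _, ⟨j⟩⟩ := exists_isGalois_algHom K L
  let : Algebra R N := ((algebraMap K N).comp (algebraMap R K)).toAlgebra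
  let : Algebra B N := (j.toRingHom.comp (algebraMap B L)).toAlgebra
  have : IsScalarTower R K N := .of_algebraMap_eq fun _ => rfl
  have : IsScalarTower R B N := .of_algebraMap_eq fun r => by
    change algebraMap K N (algebraMap R K r) = j (algebraMap B L (algebraMap R B r))
    rw [← IsScalarTower.algebraMap_apply R B L, IsScalarTower.algebraMap_apply R K L, j.commutes]
  have hBN : Function.Injective (algebraMap B N) :=
    j.injective.comp (IsFractionRing.injective B L)
  have hfr : Module.finrank K j.fieldRange = Module.finrank K L :=
    (AlgEquiv.ofInjectiveField j).toLinearEquiv.finrank_eq.symm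
  obtain ⟨S, hS, hgen⟩ := exists_isThin_isGeneric hY hU ⟨_, hα⟩ (K := K) (N := N)
  -- `S'` removes the `β` at which `ℚ(Q)` collapses to `ℚ`. The condition on the degree empties it
  -- for degree `1`, where rational points in the fibre are harmless.
  let S' : Set (RatPt Y) := {β | 2 ≤ degree hX f ∧ ∃ w : RatPt X, w ≫ f = β}
  have hS' : IsThin S' := by
    by_cases h : 2 ≤ degree hX f
    · convert isThin_range hX f h using 1
      exact Set.ext fun β => and_iff_right h
    · convert isThin_empty (Y := Y) using 1
      exact Set.eq_empty_of_forall_notMem fun β hβ => h hβ.1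
  refine ⟨S ∪ S', hS.union hS', fun β hβ => ?_⟩
  obtain ⟨hβU, hβg⟩ := hgen β fun h => hβ (.inl h)
  obtain ⟨⟨φ, hφ⟩, horb, hprim'⟩ := hβg.pointsOver (B := B) hBN j.fieldRange (fun x => ⟨_, rfl⟩)
    (intermediateField_le_fieldRange j hbt)
  refine ⟨?_, fun Q hQ => ?_⟩
  · obtain ⟨Q, hQV, hQ, -⟩ := AlgPt.exists_mem_fibre hU hV le_rfl hβU hφ
    refine ⟨Q, subset_antisymm (fun Q' hQ' => ?_) ?_⟩
    · obtain ⟨τ, hτ⟩ := horb _ (hfield hβU hQ).1 _ (hfield hβU hQ').1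
      have hQτ := hVfib hβU (AlgPt.conj_mem_fibre hQ τ)
      refine ⟨τ, AlgPt.ext_eval hV hQτ (hVfib hβU hQ') ?_⟩
      rw [hτ, Q.eval_conj τ hV (hVfib hβU hQ)]
    · rintro _ ⟨τ, rfl⟩
      exact AlgPt.conj_mem_fibre hQ τ
  · obtain ⟨h1, h2⟩ := hfield hβU hQ
    obtain ⟨h3, h4⟩ := hprim' _ h1
    rw [← h2] at h3 h4
    refine ⟨h3, ?_⟩
    rcases h4 with h4 | h4
    -- If `ℚ(Q) = ℚ` then `Q` comes from a rational point above `β`; as `β ∉ S'`, the degree is `1`,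
    -- which is the degree of `ℚ(Q)`.
    · have hlt : ¬ 2 ≤ degree hX f := fun h => by
        obtain ⟨c, hc⟩ := exists_comp_algebraMap_eq_of_mem_bot (Q.eval (hVfib hβU hQ)) fun x => by
          rw [← h4, h2]
          exact IntermediateField.subset_adjoin _ _ ⟨x, rfl⟩
        refine hβ (.inr ⟨h, RatPt.exists_comp_eq hU hV le_rfl hβU (φ := c) ?_⟩)
        refine RingHom.ext fun r => (algebraMap ℚ Qbar).injective ?_
        exact (congr($hc (i r))).trans congr($h1 r)
      have hpos : 0 < Module.finrank K L := Module.finrank_pos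
      rw [h4, IntermediateField.finrank_bot]
      omega
    · rw [h4, hfr, hdeg]

end Main

/-! ### Specializations in dimension one -/

section Dimension

/-- In a domain of dimension at most one the prime of `x` is either maximal, so `x` has no proper
specialization in `U`, or zero, so `x` is generic in `U` and by density in `X`. -/
theorem eq_or_forall_specializes {X : Scheme.{0}} [IrreducibleSpace X] {x z : X} (h : x ⤳ z)
    {U : X.Opens} (hU : IsAffineOpen U) (hz : z ∈ U) [IsDomain Γ(X, U)]
    [Ring.DimensionLEOne Γ(X, U)] : x = z ∨ ∀ y, x ⤳ y := by
  have hx : x ∈ U := h.mem_open U.isOpen hz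
  have hle : hU.primeIdealOf ⟨x, hx⟩ ⤳ hU.primeIdealOf ⟨z, hz⟩ := by
    refine hU.fromSpec.isOpenEmbedding.isInducing.specializes_iff.1 ?_
    have h1 := hU.fromSpec_primeIdealOf ⟨x, hx⟩
    have h2 := hU.fromSpec_primeIdealOf ⟨z, hz⟩
    exact (congrArg₂ (· ⤳ ·) h1 h2).mpr h
  by_cases h0 : (hU.primeIdealOf ⟨x, hx⟩).asIdeal = ⊥
  · right
    have hd : Dense (U : Set X) := U.isOpen.dense ⟨z, hz⟩
    have hUx : (U : Set X) ⊆ closure {x} := fun y hy => by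
      have h1 := hU.fromSpec_primeIdealOf ⟨x, hx⟩
      have h2 := hU.fromSpec_primeIdealOf ⟨y, hy⟩
      rw [← specializes_iff_mem_closure]
      refine (congrArg₂ (· ⤳ ·) h1 h2).mp (Specializes.map ?_ hU.fromSpec.continuous)
      refine (PrimeSpectrum.le_iff_specializes _ _).1 ?_
      rw [← PrimeSpectrum.asIdeal_le_asIdeal, h0]
      exact bot_le
    intro y
    rw [specializes_iff_mem_closure]
    exact closure_minimal hUx isClosed_closure (hd y)
  · left
    rw [← PrimeSpectrum.le_iff_specializes, ← PrimeSpectrum.asIdeal_le_asIdeal] at hle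
    have hm := Ring.DimensionLEOne.maximalOfPrime h0 (hU.primeIdealOf ⟨x, hx⟩).isPrime
    have := PrimeSpectrum.ext (hm.eq_of_le (hU.primeIdealOf ⟨z, hz⟩).isPrime.ne_top hle)
    exact (hU.fromSpec_primeIdealOf ⟨x, hx⟩).symm.trans
      (congr(hU.fromSpec $this).trans (hU.fromSpec_primeIdealOf ⟨z, hz⟩))

end Dimension

/-! ### Projective space: charts, properness, irreducibility -/

section ProjSpace

open MvPolynomial HomogeneousLocalization

theorem _root_.MvPolynomial.IsHomogeneous.eval₂_mul {R S σ : Type*} [CommSemiring R] [CommSemiring S] {p : MvPolynomial σ R} {n : ℕ}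
    (hp : p.IsHomogeneous n) (f : R →+* S) (g : σ → S) (u : S) :
    eval₂ f (fun i => g i * u) p = eval₂ f g p * u ^ n := by
  rw [eval₂_eq, eval₂_eq, Finset.sum_mul]
  refine Finset.sum_congr rfl fun d hd => ?_
  rw [hp.degree_eq_sum_deg_support hd, mul_assoc, ← Finset.prod_pow_eq_pow_sum,
    ← Finset.prod_mul_distrib]
  simp_rw [mul_pow]

theorem X_mem {n : ℕ} (i : Fin (n + 1)) : X i ∈ polyGrading n 1 := isHomogeneous_X _ _

/-- `ℚ[x₀, …, xₙ] → ℚ[x₀ / xᵢ, …, xₙ / xᵢ]`. -/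
def toAway {n : ℕ} (i : Fin (n + 1)) :
    MvPolynomial (Fin (n + 1)) ℚ →+* Away (polyGrading n) (X i) :=
  eval₂Hom ((fromZeroRingHom (polyGrading n) _).comp (algebraMap ℚ (polyGrading n 0)))
    fun j => Away.mk (polyGrading n) (X_mem i) 1 (X j) (X_mem j)

theorem toAway_surjective {n : ℕ} (i : Fin (n + 1)) : Function.Surjective (toAway i) := by
  intro y
  obtain ⟨m, a, ha, rfl⟩ := Away.mk_surjective (polyGrading n) (X_mem i) y
  refine ⟨a, ?_⟩
  have ha' : a.IsHomogeneous m := by simpa using ha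
  apply HomogeneousLocalization.val_injective
  let S := Localization.Away (X i : MvPolynomial (Fin (n + 1)) ℚ)
  let v : Away (polyGrading n) (X i) →+* S := algebraMap _ _
  let ι : MvPolynomial (Fin (n + 1)) ℚ →+* S := algebraMap _ _
  let u : S := Localization.mk 1 ⟨X i, 1, pow_one _⟩
  -- By homogeneity, substituting `xⱼ / xᵢ` in `a` divides it by `xᵢ ^ m`.
  have h1 : v (toAway i a) = ι a * u ^ m := by
    have h2 : ι a = eval₂ (ι.comp C) (fun j => ι (X j)) a := by
      rw [← coe_eval₂Hom]
      exact congr($(ringHom_ext (f := ι) (g := eval₂Hom (ι.comp C) fun j => ι (X j))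
        (by simp) (by simp)) a)
    rw [h2, ← ha'.eval₂_mul, ← RingHom.comp_apply, toAway, comp_eval₂Hom, coe_eval₂Hom]
    refine congrArg₂ (fun f g => eval₂ f g a) (Subsingleton.elim (α := ℚ →+* S) _ _) ?_
    · funext j
      change (Away.mk (polyGrading n) (X_mem i) 1 (X j) (X_mem j)).val = ι (X j) * u
      rw [Away.val_mk, ← Localization.mk_one_eq_algebraMap, Localization.mk_mul]
      congr 1
      rw [mul_one]
  refine h1.trans ?_
  rw [Away.val_mk, ← Localization.mk_one_eq_algebraMap, Localization.mk_pow, Localization.mk_mul]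
  congr 1
  · simp
  · apply Subtype.ext
    simp

theorem toAway_X_self {n : ℕ} (i : Fin (n + 1)) : toAway i (X i) = 1 := by
  apply HomogeneousLocalization.val_injective
  rw [toAway, coe_eval₂Hom, eval₂_X, Away.val_mk, HomogeneousLocalization.val_one,
    Localization.mk_eq_mk', IsLocalization.mk'_eq_iff_eq_mul]
  simp

instance {n : ℕ} (i : Fin (n + 1)) : IsDomain (Away (polyGrading n) (X i)) := by
  have : IsDomain (Localization.Away (X i : MvPolynomial (Fin (n + 1)) ℚ)) :=
    IsLocalization.isDomain_localization
      (powers_le_nonZeroDivisors_of_noZeroDivisors (X_ne_zero i))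
  exact Function.Injective.isDomain (algebraMap (Away (polyGrading n) (X i)) (Localization.Away
    (X i : MvPolynomial (Fin (n + 1)) ℚ))) (HomogeneousLocalization.val_injective _)

/-- Since `toAway i` is surjective and sends `X i` to `1`, it factors through polynomials in the
other variable, of index `i + 1` in `Fin 2`. The chart is thus a quotient of `ℚ[T]`. -/
instance (i : Fin (1 + 1)) : IsPrincipalIdealRing (Away (polyGrading 1) (X i)) := by
  let ψ : Polynomial ℚ →+* Away (polyGrading 1) (X i) :=
    Polynomial.eval₂RingHom ((toAway i).comp C) (toAway i (X (i + 1)))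
  let d : MvPolynomial (Fin 2) ℚ →+* Polynomial ℚ :=
    eval₂Hom Polynomial.C (fun k => if k = i then 1 else Polynomial.X)
  have h : ψ.comp d = toAway i := by
    refine ringHom_ext (fun q => by simp [ψ, d]) fun k => ?_
    by_cases hk : k = i
    · simp [ψ, d, hk, toAway_X_self]
    · obtain rfl : k = i + 1 := by lia
      simp [ψ, d]
  refine IsPrincipalIdealRing.of_surjective ψ (.of_comp (g := d) ?_)
  rw [← RingHom.coe_comp, h]
  exact toAway_surjective i

theorem adjoin_range_X (n : ℕ) :
    Algebra.adjoin (polyGrading n 0) (Set.range (X : Fin (n + 1) → MvPolynomial (Fin (n + 1)) ℚ)) = ⊤ := by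
  have h := MvPolynomial.adjoin_range_X (R := ℚ) (σ := Fin (n + 1))
  refine top_le_iff.1 fun x _ => ?_
  have hx : x ∈ Algebra.adjoin ℚ (Set.range (X : Fin (n + 1) → MvPolynomial (Fin (n + 1)) ℚ)) :=
    h ▸ Algebra.mem_top
  induction hx using Algebra.adjoin_induction with
  | mem x hx => exact Algebra.subset_adjoin hx
  | algebraMap r => exact Subalgebra.algebraMap_mem _ (⟨C r, isHomogeneous_C _ _⟩ : polyGrading n 0)
  | add x y _ _ hx hy => exact add_mem (hx trivial) (hy trivial)
  | mul x y _ _ hx hy => exact mul_mem (hx trivial) (hy trivial)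

instance (n : ℕ) : Algebra.FiniteType (polyGrading n 0) (MvPolynomial (Fin (n + 1)) ℚ) := by
  classical
  refine ⟨⟨Finset.univ.image X, ?_⟩⟩
  rw [Finset.coe_image, Finset.coe_univ, Set.image_univ, adjoin_range_X]

theorem algebraMap_polyGrading_bijective (n : ℕ) :
    Function.Bijective (algebraMap ℚ (polyGrading n 0)) := by
  have : Nontrivial (polyGrading n 0) := ⟨0, 1, fun h => zero_ne_one congr(($h).1)⟩
  refine ⟨(algebraMap ℚ (polyGrading n 0)).injective, fun ⟨x, hx⟩ => ?_⟩
  have hx' : x ∈ homogeneousSubmodule (Fin (n + 1)) ℚ 0 := hx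
  rw [homogeneousSubmodule_zero, Submodule.mem_one] at hx'
  obtain ⟨q, rfl⟩ := hx'
  exact ⟨q, rfl⟩

instance (n : ℕ) : IsProper (projSpace n).hom := by
  have : IsIso (CommRingCat.ofHom (algebraMap ℚ (polyGrading n 0))) :=
    (ConcreteCategory.isIso_iff_bijective _).2 (algebraMap_polyGrading_bijective n)
  change IsProper (Proj.toSpecZero (polyGrading n) ≫
    Spec.map (CommRingCat.ofHom (algebraMap ℚ (polyGrading n 0))))
  infer_instance

/-- The zero ideal is a relevant homogeneous prime, and it is a generic point. -/
instance (n : ℕ) : IrreducibleSpace (projSpace n).left := by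
  let η : ProjectiveSpectrum (polyGrading n) :=
    ⟨⊥, Ideal.isPrime_bot, fun h => X_ne_zero (R := ℚ) (0 : Fin (n + 1)) <| by
      have : (X 0 : MvPolynomial (Fin (n + 1)) ℚ) ∈
          (⊥ : HomogeneousIdeal (polyGrading n)).toIdeal := h <| by
        change (X 0 : MvPolynomial (Fin (n + 1)) ℚ) ∈ HomogeneousIdeal.irrelevant (polyGrading n)
        rw [HomogeneousIdeal.mem_irrelevant_iff, GradedRing.proj_apply,
          DirectSum.decompose_of_mem_ne (polyGrading n) (X_mem 0) one_ne_zero]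
      simp at this⟩
  have h : closure {η} = (⊤ : Set (ProjectiveSpectrum (polyGrading n))) := Set.eq_univ_of_forall fun y =>
    (ProjectiveSpectrum.le_iff_mem_closure _ _ _).1 (bot_le (a := y.asHomogeneousIdeal))
  change IrreducibleSpace (ProjectiveSpectrum (polyGrading n))
  rw [irreducibleSpace_def, ← h]
  exact isIrreducible_singleton.closure

theorem P1.exists_isAffineOpen (y : P1.left) : ∃ U : P1.left.Opens, IsAffineOpen U ∧ y ∈ U ∧
    IsDomain Γ(P1.left, U) ∧ IsPrincipalIdealRing Γ(P1.left, U) := by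
  have h := Proj.iSup_basicOpen_eq_top' (polyGrading 1) X (fun i => ⟨1, X_mem i⟩) (adjoin_range_X 1)
  obtain ⟨i, hi⟩ := TopologicalSpace.Opens.mem_iSup.1
    (h.symm ▸ TopologicalSpace.Opens.mem_top (α := Proj (polyGrading 1)) y)
  let e : Away (polyGrading 1) (X i) ≃+* Γ(Proj (polyGrading 1), Proj.basicOpen (polyGrading 1) (X i)) :=
    (Proj.basicOpenIsoAway (polyGrading 1) (X i) (X_mem i) one_pos).commRingCatIsoToRingEquiv
  exact ⟨Proj.basicOpen (polyGrading 1) (X i), Proj.isAffineOpen_basicOpen _ _ (X_mem i) one_pos,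
    hi, e.symm.toMulEquiv.isDomain _, IsPrincipalIdealRing.of_surjective e e.surjective⟩

end ProjSpace

/-! ### Curves: dimension, and finiteness of non-constant morphisms to the line -/

theorem dimensionLEOne_of_quasiFinite (A B : Type*) [CommRing A] [CommRing B] [IsDomain B]
    [Algebra A B] [Ring.DimensionLEOne A] [Algebra.QuasiFinite A B] : Ring.DimensionLEOne B := by
  refine ⟨fun {p} hp0 hp => ?_⟩
  obtain ⟨m, hm, hpm⟩ := Ideal.exists_le_maximal p hp.ne_top
  -- Quasi-finiteness forbids strict inclusions between primes over the same prime of `A`: first a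
  -- nonzero `p` contracts to a nonzero, hence maximal, prime, and then `p` equals any maximal ideal
  -- above it.
  have hp' : p.under A ≠ ⊥ := fun h => hp0 <| by
    refine (Algebra.QuasiFinite.eq_of_le_of_under_eq (R := A) ⊥ p bot_le ?_).symm
    exact le_antisymm (Ideal.comap_mono bot_le) (h ▸ bot_le)
  have h1 := (Ring.DimensionLEOne.maximalOfPrime hp' inferInstance).eq_of_le
    (Ideal.IsPrime.under A m).ne_top (Ideal.comap_mono hpm)
  rwa [Algebra.QuasiFinite.eq_of_le_of_under_eq (R := A) p m hpm h1]

theorem dimensionLEOne_mvPolynomial (k : Type*) [Field k] :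
    Ring.DimensionLEOne (MvPolynomial (Fin 1) k) := by
  have : IsPrincipalIdealRing (MvPolynomial (Fin 1) k) :=
    IsPrincipalIdealRing.of_surjective (MvPolynomial.uniqueAlgEquiv k (Fin 1)).symm
      (MvPolynomial.uniqueAlgEquiv k (Fin 1)).symm.surjective
  infer_instance

/-- Such an algebra is étale, hence quasi-finite, over a polynomial ring in one variable. -/
theorem dimensionLEOne_of_isStandardSmooth {k B : Type*} [CommRing k] [CommRing B] [IsDomain B]
    (hk : IsField k) {g : k →+* B} (hg : g.IsStandardSmoothOfRelativeDimension 1) :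
    Ring.DimensionLEOne B := by
  let := hk.toField
  obtain ⟨φ, -, hφ⟩ := hg.exists_etale_mvPolynomial
  algebraize [φ]
  have := dimensionLEOne_mvPolynomial k
  exact dimensionLEOne_of_quasiFinite (MvPolynomial (Fin 1) k) B

theorem isField_sections_base (U : base.Opens) (h : (U : Set base).Nonempty) :
    IsField Γ(base, U) := by
  obtain rfl : U = ⊤ := by
    obtain ⟨x, hx⟩ := h
    refine top_le_iff.1 fun y _ => ?_
    have : Subsingleton base := inferInstanceAs (Subsingleton (PrimeSpectrum ℚ))
    rwa [Subsingleton.elim y x]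
  exact (Scheme.ΓSpecIso (.of ℚ)).commRingCatIsoToRingEquiv.toMulEquiv.isField
    (Field.toIsField ℚ)

variable {C : QSch}

theorem IsCurve.exists_isAffineOpen (hC : IsCurve C) (x : C.left) :
    ∃ V : C.left.Opens, IsAffineOpen V ∧ x ∈ V ∧ IsDomain Γ(C.left, V) ∧
      Ring.DimensionLEOne Γ(C.left, V) := by
  have := hC.isVariety.isIntegral
  obtain ⟨U, hU, V, hV, hx, e, h⟩ := hC.smooth.exists_isStandardSmoothOfRelativeDimension x
  have : Nonempty V := ⟨⟨x, hx⟩⟩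
  exact ⟨V, hV, hx, inferInstance,
    dimensionLEOne_of_isStandardSmooth (isField_sections_base U ⟨_, e hx⟩) h⟩

theorem IsCurve.eq_of_specializes (hC : IsCurve C) {x z : C.left} (h : x ⤳ z)
    (hx : ¬ ∀ y, x ⤳ y) : x = z := by
  have := hC.isVariety.isIntegral
  obtain ⟨V, hV, hz, _, _⟩ := hC.exists_isAffineOpen z
  exact (eq_or_forall_specializes h hV hz).resolve_right hx

theorem P1.eq_of_specializes {x z : P1.left} (h : x ⤳ z)
    (hx : ¬ ∀ y, x ⤳ y) : x = z := by
  obtain ⟨V, hV, hz, _, _⟩ := P1.exists_isAffineOpen z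
  exact (eq_or_forall_specializes h hV hz).resolve_right hx

theorem isClosed_singleton_of_forall_eq {X : Type*} [TopologicalSpace X] {x : X}
    (h : ∀ z, x ⤳ z → x = z) : IsClosed {x} := by
  refine isClosed_of_closure_subset fun z hz => ?_
  exact (h z (specializes_iff_mem_closure.2 hz)).symm

theorem IsCurve.isProper (hC : IsCurve C) : IsProper C.hom := by
  obtain ⟨n, i, hi⟩ := hC.isProjective
  rw [← Over.w i]
  infer_instance

/-- By noetherianity `Z` is a finite union of irreducible closed sets. The generic point of each is
not generic in `C`, so it specializes only to itself and the set is a single point. -/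
theorem IsCurve.finite_of_isClosed (hC : IsCurve C) {Z : Set C.left} (hZ : IsClosed Z)
    (hZ' : Z ≠ Set.univ) : Z.Finite := by
  have := hC.isVariety.isIntegral
  have := hC.isVariety.locallyOfFiniteType
  have := hC.isVariety.quasiCompact
  have : IsLocallyNoetherian C.left := LocallyOfFiniteType.isLocallyNoetherian C.hom
  have : CompactSpace C.left := QuasiCompact.compactSpace_of_compactSpace C.hom
  have : IsNoetherian C.left := {}
  obtain ⟨S, hS, hSc, hSi, rfl⟩ :=
    TopologicalSpace.NoetherianSpace.exists_finite_set_isClosed_irreducible hZ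
  refine hS.sUnion fun T hT => ?_
  obtain ⟨x, hx⟩ := QuasiSober.sober (hSi T hT) (hSc T hT)
  refine (Set.finite_singleton x).subset fun z hz => ?_
  refine (hC.eq_of_specializes (hx.specializes hz) fun h => hZ' ?_).symm
  exact Set.eq_univ_of_forall fun y => ⟨T, hT, (h y).mem_closed (hSc T hT) hx.mem⟩

variable (f : C ⟶ P1)

theorem IsCurve.isProper_hom (hC : IsCurve C) : IsProper f.left := by
  have := hC.isProper
  have h : f.left ≫ P1.hom = C.hom := Over.w f
  have : IsProper (f.left ≫ P1.hom) := by rwa [h]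
  exact IsProper.of_comp f.left P1.hom

/-- Otherwise the image of the generic point would have no proper specialization; but it specializes
to every `f x`, so `f` would be constant. -/
theorem IsCurve.map_genericPoint_specializes (hC : IsCurve C) (hf : ¬ IsConstant f) (y : P1.left) :
    haveI := hC.isVariety.isIntegral
    f.left (genericPoint C.left) ⤳ y := by
  have := hC.isVariety.isIntegral
  by_contra h
  refine hf ⟨f.left (genericPoint C.left), fun x => ?_⟩
  exact (P1.eq_of_specializes ((genericPoint_specializes x).map f.left.continuous)
    fun h' => h (h' y)).symm

/-- Above the image of the generic point `ξ` only `ξ` can lie: any other point is closed, and since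
`f` is a closed map `f ξ` would be closed too, making `f` constant. Above any other `y`, the
preimage of the closure of `y` is closed and misses `ξ`, so it is finite. -/
theorem IsCurve.finite_preimage (hC : IsCurve C) (hf : ¬ IsConstant f) (y : P1.left) :
    (f.left ⁻¹' {y}).Finite := by
  have := hC.isVariety.isIntegral
  have hp := hC.isProper_hom f
  have hcl : IsClosedMap f.left := f.left.isClosedMap
  set ξ := genericPoint C.left
  by_cases hy : y = f.left ξ
  · refine (Set.finite_singleton ξ).subset fun x hx => ?_
    by_contra hxξ
    have hxc : IsClosed {x} := isClosed_singleton_of_forall_eq fun z hz =>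
      hC.eq_of_specializes hz fun h => hxξ ((h ξ).antisymm (genericPoint_specializes x)).eq
    have h1 := hcl _ hxc
    rw [Set.image_singleton] at h1
    refine hf ⟨f.left x, fun z => ?_⟩
    have h2 : f.left x ⤳ f.left z := by
      rw [show f.left x = f.left ξ from (hx : f.left x = y).trans hy]
      exact (genericPoint_specializes z).map f.left.continuous
    exact h2.mem_closed h1 rfl
  · refine (hC.finite_of_isClosed
      ((isClosed_closure (s := {y})).preimage f.left.continuous) ?_).subset
      (Set.preimage_mono subset_closure)
    intro h
    have h1 : ξ ∈ f.left ⁻¹' closure {y} := h ▸ Set.mem_univ ξ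
    have h2 : y ⤳ f.left ξ := specializes_iff_mem_closure.2 h1
    exact hy (h2.antisymm (hC.map_genericPoint_specializes f hf y)).eq

/-- Proper with finite fibres implies finite. -/
theorem IsCurve.isFinite_hom (hC : IsCurve C) (hf : ¬ IsConstant f) : IsFinite f.left := by
  have := hC.isProper_hom f
  have := LocallyQuasiFinite.of_finite_preimage_singleton f.left (hC.finite_preimage f hf)
  exact IsFinite.of_isProper_of_locallyQuasiFinite f.left

theorem IsCurve.isDominant_hom (hC : IsCurve C) (hf : ¬ IsConstant f) : IsDominant f.left := by
  have := hC.isVariety.isIntegral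
  refine ⟨fun y => ?_⟩
  exact closure_mono (Set.singleton_subset_iff.2 (Set.mem_range_self (genericPoint C.left)))
    (specializes_iff_mem_closure.1 (hC.map_genericPoint_specializes f hf y))

/-- The locus where a nonzero function is invertible is open and nonempty, so it contains the image
of the generic point of `C`, and the pullback is nonzero there. -/
theorem IsCurve.app_injective (hC : IsCurve C) (hf : ¬ IsConstant f) {U : P1.left.Opens}
    (hU : IsAffineOpen U) [IsDomain Γ(P1.left, U)] : Function.Injective (f.left.app U) := by
  have := hC.isVariety.isIntegral
  change Function.Injective (f.left.app U).hom
  rw [injective_iff_map_eq_zero]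
  intro r hr
  by_contra h0
  have h1 : P1.left.basicOpen r ≠ ⊥ := fun h => h0 <|
    ((Scheme.isNilpotent_iff_basicOpen_eq_bot_of_isCompact hU.isCompact r).2 h).eq_zero
  obtain ⟨y, hy⟩ := (TopologicalSpace.Opens.ne_bot_iff_nonempty _).1 h1
  have h2 : genericPoint C.left ∈ f.left ⁻¹ᵁ P1.left.basicOpen r :=
    (hC.map_genericPoint_specializes f hf y).mem_open (P1.left.basicOpen r).isOpen hy
  rw [Scheme.preimage_basicOpen] at h2
  have h3 : f.left.app U r = 0 := hr
  rw [h3, Scheme.basicOpen_zero] at h2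
  exact h2

end PrimPts

end

theorem mainTheorem9 (C : PrimPts.QSch) (hC : PrimPts.IsCurve C)
    (f : C ⟶ PrimPts.P1) (hf : ¬ PrimPts.IsConstant f)
    (α : PrimPts.RatPt PrimPts.P1) (hα : ¬ PrimPts.IsBranchValue f α)
    (hfib : PrimPts.IsGaloisOrbit (PrimPts.fibre f α))
    (P : PrimPts.AlgPt C) (hP : P ∈ PrimPts.fibre f α)
    (hprim : PrimPts.IsPrimitiveField P.field) :
    Module.finrank ℚ P.field = PrimPts.degree hC.isVariety f ∧
    ∃ S : Set (PrimPts.RatPt PrimPts.P1), PrimPts.IsThin S ∧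
      ∀ β : PrimPts.RatPt PrimPts.P1, β ∉ S →
        PrimPts.IsGaloisOrbit (PrimPts.fibre f β) ∧
        ∀ Q ∈ PrimPts.fibre f β,
          PrimPts.IsPrimitiveField Q.field ∧
          Module.finrank ℚ Q.field = PrimPts.degree hC.isVariety f := by
  have := hC.isFinite_hom f hf
  have := hC.isDominant_hom f hf
  -- One chart around `α` is enough: rational points outside it are absorbed in the thin set.
  obtain ⟨U, hU, hαU, _, _⟩ := PrimPts.P1.exists_isAffineOpen α.pt
  exact PrimPts.finrank_field_and_exists_isThin hC.isVariety inferInstance f hU hαU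
    (hC.app_injective f hf hU) hα hfib P hP hprim
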